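/- **The overlay.** A $D^2$-tree of height $H\ge 0$ consists of a perfect binary tree of height $H$ and, for each of its $2^H$ leaves, a nonempty bucket of further nodes, of which that leaf is the representative. Level $\ell\le H$ consists of the $2^\ell$ tree nodes at depth $\ell$; the nodes of all the buckets, from left to right, form level $H+1$. Let $N$ be the total number of nodes (tree nodes and bucket nodes). Fix constants $a,b>0$ and assume that the buckets have size $\Theta(\log N)$ in the following sense: every bucket has at most $b\log N$ nodes, and the average bucket size is at least $a\log N$. The in-order sequence of the tree, with each bucket placed directly after its representative, is the order of the keys. Every tree node is linked to its father, its children and its in-order neighbours in the tree; a representative is linked to the first node of its bucket, and a bucket node to its representative and to its neighbours in the bucket. In addition there are links inside each level. Consider a level of $M$ nodes, numbered $0,\dots,M-1$, and put $L=\lceil\log_2 M\rceil$ (so $L=\ell$ if $M=2^\ell$). 1. *Routing tables.* Each node is linked to the nodes at distance $2^0,2^1,\dots,2^{L-1}$ to the left and to the right (as far as they exist). A horizontal search follows, at each step, the longest link that does not overshoot. 2. *Hypernodes.* The level is cut into hypernodes, consecutive groups of $s=\max(L,2)$ nodes with ranks $1,\dots,s$ from left to right (the last group may be incomplete). A node is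 linked to the nodes of neighbouring rank and to the node of highest rank in its hypernode (for an incomplete last hypernode: in the preceding one), and, if its rank is $i$, in both directions to the node at distance $2^i$ if this lies in the same hypernode, and otherwise to the node of rank $i$ (or the last node, if there are fewer than $i$) in the hypernode that contains the position at distance $2^i$. A horizontal search first goes to the node of highest rank; then, at a node outside the hypernode of its destination, it follows the exponential link of that node if this leads to another hypernode that is not beyond the one of the destination, and else goes to the next lower rank; in the hypernode of the destination it walks through neighbouring ranks. **Searches.** The search issued by a node $v$ at level $\ell$ for a target node $z$ has two phases. The horizontal phase moves inside level $\ell$ from $v$ to a node $u$: if $z$ is at level at least $\ell$, then $u$ is the node of level $\ell$ that is $z$ or an ancestor of $z$ (the ancestors of a bucket node being its representative and the ancestors of this one); if $z$ is an internal tree node above level $\ell$, then $u$ is the last node of level $\ell$ before $z$ if $v$ is before $z$, and the first node of level $\ell$ after $z$ if $v$ is after $z$; if $v$ is a bucket node and $z$ a leaf of the tree, then $u$ is the first node of the bucket of $z$. The vertical phase is empty if $u=z$. Otherwise, if $u$ is an internal tree node, the search first visits its two in-order neighbours in the tree and returns to $u$; then it moves along the tree (and along the list of a bucket) from $u$ up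 or down to $z$. **Congestion.** Each of the $N$ nodes issues one search; the $N$ targets are chosen independently and uniformly at random among all $N$ nodes. The congestion is the maximum over all nodes $x$ of the expected number of searches that visit $x$, divided by $N$. **Theorem.** For all $a,b>0$ there is a constant $C$ such that the following holds for every $D^2$-tree as above. * With routing tables: every node stores at most $C\log N$ links; every search proceeds along stored links from its source to its target; the expected number of searches whose horizontal phase visits a given node of level $\ell$ is at most $C(\ell+1)$; the expected number of searches whose vertical phase visits a given node is at most $C$; and the congestion is at most $C\,\frac{\log N}{N}$. * With hypernodes: every node stores at most $C$ links; every search proceeds along stored links from its source to its target; and the congestion is at most $C\,\frac{\log N}{N}$. -/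

import Mathlib

open scoped BigOperators

/-- A `D²`-tree overlay: a perfect binary tree of height `height`, whose `i`-th leaf (from the left,
`i < 2 ^ height`) is the representative of a nonempty bucket of `bucketSize i` further nodes,
arranged in a doubly linked list. The values `bucketSize i` with `2 ^ height ≤ i` are irrelevant. -/
structure D2Tree where
  height : ℕ
  bucketSize : ℕ → ℕ
  bucket_pos : ∀ i < 2 ^ height, 0 < bucketSize i

/-- The two ways of storing the links inside a level: full routing tables at every node, or
routing tables distributed over hypernodes. -/
inductive Routing where
  | table
  | hyper

/-! ### Routing inside one row of nodes

A row is a left-to-right sequence of `M` nodes, numbered `0, …, M - 1`. -/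

namespace Row

/-- The sequence of positions visited when `step` is applied from `c` on until `q` is reached
(at most `fuel` steps). -/
def follow (step : ℕ → ℕ) (q : ℕ) : ℕ → ℕ → List ℕ
  | 0, c => [c]
  | fuel + 1, c => if c = q then [c] else c :: follow step q fuel (step c)

/-- Routing table step from `c ≠ q` towards `q`: the longest link (its length is a power of two)
that does not overshoot. -/
def tableStep (q c : ℕ) : ℕ :=
  if c < q then c + 2 ^ Nat.log 2 (q - c) else c - 2 ^ Nat.log 2 (c - q)

/-- Size of a (complete) hypernode. A level `ℓ` has `2 ^ ℓ` nodes and `Nat.clog 2 (2 ^ ℓ) = ℓ`.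
(The two nodes of level `1` form one hypernode.) The hypernodes of a row are the consecutive groups
of this many nodes; the last one may be incomplete. -/
def hyperSize (M : ℕ) : ℕ := max (Nat.clog 2 M) 2

/-- The hypernode of position `c`. -/
def hyperOf (M c : ℕ) : ℕ := c / hyperSize M

/-- The rank `1, 2, …` of position `c` in its hypernode. -/
def rank (M c : ℕ) : ℕ := c % hyperSize M + 1

/-- The node of highest rank of the hypernode of `c`; the nodes of an incomplete last hypernode
use the one of the preceding hypernode. -/
def top (M c : ℕ) : ℕ :=
  if (hyperOf M c + 1) * hyperSize M ≤ M then (hyperOf M c + 1) * hyperSize M - 1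
  else if hyperOf M c = 0 then M - 1
  else hyperOf M c * hyperSize M - 1

/-- The hypernode which contains the position `2 ^ i` to the right of `c`, `i` the rank of `c`. -/
def rightHyper (M c : ℕ) : ℕ := hyperOf M (c + 2 ^ rank M c)

/-- The end point of the right link of `c`, of rank `i`: the node at distance `2 ^ i`, if it is in
the same hypernode; otherwise the node of rank `i` in the hypernode `rightHyper M c` (its last node
if that hypernode is incomplete and has fewer than `i` nodes). The link exists only if that
hypernode does, that is, if `rightHyper M c * hyperSize M < M`. -/
def rightEnd (M c : ℕ) : ℕ :=
  if rightHyper M c = hyperOf M c then c + 2 ^ rank M c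
  else min (rightHyper M c * hyperSize M + (rank M c - 1)) (M - 1)

/-- The hypernode which contains the position `2 ^ i` to the left of `c`, `i` the rank of `c`.
It is different from the one of `c`, as `i ≤ 2 ^ i`. -/
def leftHyper (M c : ℕ) : ℕ := hyperOf M (c - 2 ^ rank M c)

/-- The end point of the left link of `c`; the link exists only if `2 ^ rank M c ≤ c`. -/
def leftEnd (M c : ℕ) : ℕ := leftHyper M c * hyperSize M + (rank M c - 1)

/-- One step from `c ≠ q` towards `q` with hypernodes. In the hypernode of `q`, walk to the
neighbour in rank. Otherwise take the exponential link of `c` if it leads to another hypernode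
not beyond that of `q`, and go back to the next lower rank if not. -/
def hyperStep (M q c : ℕ) : ℕ :=
  if hyperOf M c = hyperOf M q then (if c < q then c + 1 else c - 1)
  else if hyperOf M c < hyperOf M q then
    (if hyperOf M c < rightHyper M c ∧ rightHyper M c ≤ hyperOf M q then rightEnd M c else c - 1)
  else
    (if 2 ^ rank M c ≤ c ∧ hyperOf M q ≤ leftHyper M c then leftEnd M c else c - 1)

/-- The horizontal search path from `p` to `q` in a row of `M` nodes. With hypernodes the search
first moves to the node of highest rank. (The numbers of steps allowed always suffice.) -/
def route : Routing → ℕ → ℕ → ℕ → List ℕ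
  | .table, M, p, q => follow (tableStep q) q M p
  | .hyper, M, p, q =>
    if p = q then [p]
    else if p = top M p then follow (hyperStep M q) q (4 * M + 4) p
    else p :: follow (hyperStep M q) q (4 * M + 4) (top M p)

/-- In a row of `M` nodes, the node at position `c` stores a link to the one at position `d`. -/
def Link : Routing → ℕ → ℕ → ℕ → Prop
  | .table, M, c, d => ∃ i < Nat.clog 2 M, d = c + 2 ^ i ∨ c = d + 2 ^ i
  | .hyper, M, c, d =>
    (hyperOf M c = hyperOf M d ∧ (d = c + 1 ∨ c = d + 1)) ∨ d = top M c ∨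
    (rightHyper M c * hyperSize M < M ∧ d = rightEnd M c) ∨
    (2 ^ rank M c ≤ c ∧ d = leftEnd M c)

end Row

namespace D2Tree

variable (T : D2Tree)

/-- Number of bucket nodes in the buckets to the left of the `i`-th one. -/
def offset (i : ℕ) : ℕ := ∑ j ∈ Finset.range i, T.bucketSize j

/-- Number of nodes of row `r`. Row `r ≤ height` is level `r` of the perfect binary tree; row
`height + 1` consists of the nodes of all the buckets, from left to right. -/
def width (r : ℕ) : ℕ := if r ≤ T.height then 2 ^ r else T.offset (2 ^ T.height)

/-- The nodes, as pairs (row, position in the row). -/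
def nodes : Finset (ℕ × ℕ) :=
  (Finset.range (T.height + 2)).biUnion fun r => (Finset.range (T.width r)).image (Prod.mk r)

/-- The total number `N` of nodes. -/
def N : ℕ := T.nodes.card

/-- The bucket that contains the bucket node at position `q`. -/
def bucketOf (q : ℕ) : ℕ := Nat.findGreatest (fun i => T.offset i ≤ q) (2 ^ T.height)

/-- Bucket sizes are `O(log N)`, and `Ω(log N)` on average. -/
def Balanced (a b : ℝ) : Prop :=
  (∀ i < 2 ^ T.height, (T.bucketSize i : ℝ) ≤ b * Real.log T.N) ∧
  a * Real.log T.N * 2 ^ T.height ≤ T.offset (2 ^ T.height)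

/-- The leaf before (in order) an internal node `u` of the perfect binary tree. -/
def leftLeaf (u : ℕ × ℕ) : ℕ × ℕ :=
  (T.height, u.2 * 2 ^ (T.height - u.1) + 2 ^ (T.height - u.1 - 1) - 1)

/-- The leaf after (in order) an internal node `u` of the perfect binary tree. -/
def rightLeaf (u : ℕ × ℕ) : ℕ × ℕ :=
  (T.height, u.2 * 2 ^ (T.height - u.1) + 2 ^ (T.height - u.1 - 1))

/-- The links `x → y` kept in both variants: to the two children and the father, to the in-order
neighbours in the perfect binary tree, from a representative to the first node of its bucket, from
a bucket node to its representative, and between neighbours in a bucket. -/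
def VerticalLink (x y : ℕ × ℕ) : Prop :=
  (x.1 < T.height ∧ y.1 = x.1 + 1 ∧ y.2 / 2 = x.2) ∨
  (y.1 < T.height ∧ x.1 = y.1 + 1 ∧ x.2 / 2 = y.2) ∨
  (x.1 < T.height ∧ (y = T.leftLeaf x ∨ y = T.rightLeaf x)) ∨
  (y.1 < T.height ∧ (x = T.leftLeaf y ∨ x = T.rightLeaf y)) ∨
  (x.1 = T.height ∧ y = (T.height + 1, T.offset x.2)) ∨
  (x.1 = T.height + 1 ∧ y = (T.height, T.bucketOf x.2)) ∨
  (x.1 = T.height + 1 ∧ y.1 = T.height + 1 ∧ T.bucketOf x.2 = T.bucketOf y.2 ∧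
    (y.2 = x.2 + 1 ∨ x.2 = y.2 + 1))

/-- Node `x` stores a link to node `y`. -/
def Link (k : Routing) (x y : ℕ × ℕ) : Prop :=
  x ∈ T.nodes ∧ y ∈ T.nodes ∧
    (T.VerticalLink x y ∨ (x.1 = y.1 ∧ Row.Link k (T.width x.1) x.2 y.2))

/-- The space used by a node: the number of links that it stores. -/
noncomputable def space (k : Routing) (x : ℕ × ℕ) : ℕ := {y | T.Link k x y}.ncard

/-- Position of the ancestor in row `r ≤ z.1` of `z` (of `z` itself if `r = z.1`); the ancestors of
a bucket node are the representative and its ancestors. -/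
def ancestor (z : ℕ × ℕ) (r : ℕ) : ℕ :=
  if r = z.1 then z.2
  else if z.1 ≤ T.height then z.2 / 2 ^ (z.1 - r)
  else T.bucketOf z.2 / 2 ^ (T.height - r)

/-- Position in row `r > z.1` of the first descendant of the right child of `z`, for an internal
node `z`. The position before is that of the last descendant of the left child of `z`. -/
def middle (z : ℕ × ℕ) (r : ℕ) : ℕ :=
  if r ≤ T.height then z.2 * 2 ^ (r - z.1) + 2 ^ (r - z.1 - 1)
  else T.offset (z.2 * 2 ^ (T.height - z.1) + 2 ^ (T.height - z.1 - 1))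

/-- The position in the row of `v` where the horizontal phase of the search from `v` for `z` stops.
If `z` is not above this row, it is that of the ancestor of `z`. If `z` is an internal node above
the row, it is the last position before `z` (in order) if `v` is before `z`, and the first
position after `z` if `v` is after `z`. If `v` is a bucket node and `z` a representative, it is the
first node of the bucket of `z`. In any case `z` is an ancestor or a descendant of the node
reached, or equal to it. -/
def haltPos (v z : ℕ × ℕ) : ℕ :=
  if v.1 ≤ z.1 then T.ancestor z v.1
  else if z.1 < T.height then
    (if v.2 < T.middle z v.1 then T.middle z v.1 - 1 else T.middle z v.1)
  else T.offset z.2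

/-- The node where the horizontal phase stops. -/
def haltNode (v z : ℕ × ℕ) : ℕ × ℕ := (v.1, T.haltPos v z)

/-- The horizontal phase of the search from `v` for `z`: the list of the nodes visited. -/
def horizontal (k : Routing) (v z : ℕ × ℕ) : List (ℕ × ℕ) :=
  (Row.route k (T.width v.1) v.2 (T.haltPos v z)).map (Prod.mk v.1)

/-- The path in the perfect binary tree from its node `u` to the ancestor of `u` in row `r`. -/
def climb (u : ℕ × ℕ) (r : ℕ) : List (ℕ × ℕ) :=
  (List.range (u.1 - r + 1)).map fun j => (u.1 - j, u.2 / 2 ^ j)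

/-- The path from `u` up to its ancestor in row `r < u.1`; a bucket node continues with its
representative. -/
def ascend (u : ℕ × ℕ) (r : ℕ) : List (ℕ × ℕ) :=
  if u.1 ≤ T.height then climb u r else u :: climb (T.height, T.bucketOf u.2) r

/-- The path from the ancestor in row `r` of `z` down to `z`; a bucket node is reached from its
representative along the linked list of the bucket. -/
def descend (r : ℕ) (z : ℕ × ℕ) : List (ℕ × ℕ) :=
  if z.1 ≤ T.height then (climb z r).reverse
  else (climb (T.height, T.bucketOf z.2) r).reverse ++
    (List.range (z.2 - T.offset (T.bucketOf z.2) + 1)).map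
      fun j => (T.height + 1, T.offset (T.bucketOf z.2) + j)

/-- The vertical phase from `u` to `z`, an ancestor or a descendant of `u`: the list of the nodes
visited. At an internal node `u ≠ z` the search first looks at the in-order neighbours of `u`, in
order to decide on the direction. -/
def verticalFrom (u z : ℕ × ℕ) : List (ℕ × ℕ) :=
  if u = z then [u]
  else (if u.1 < T.height then [u, T.leftLeaf u, u, T.rightLeaf u] else []) ++
    (if u.1 < z.1 then T.descend u.1 z else T.ascend u z.1)

/-- The vertical phase of the search from `v` for `z`. -/
def vertical (v z : ℕ × ℕ) : List (ℕ × ℕ) := T.verticalFrom (T.haltNode v z) z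

/-- The list of the nodes visited by the search from `v` for `z`. -/
def search (k : Routing) (v z : ℕ × ℕ) : List (ℕ × ℕ) :=
  T.horizontal k v z ++ (T.vertical v z).tail

/-- `l` is a path from `v` to `z` along stored links. -/
def IsPath (k : Routing) (v z : ℕ × ℕ) (l : List (ℕ × ℕ)) : Prop :=
  l.head? = some v ∧ l.getLast? = some z ∧ l.IsChain (T.Link k)

/-- Every node `v` issues one search, for a target `t v`. If the targets are chosen independently
and uniformly at random among all the nodes, that is, if `t` is uniformly distributed among all the
maps from nodes to nodes, this is the expected number of searches (or phases of searches) that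
visit the node `x`. -/
noncomputable def expectedVisits (path : ℕ × ℕ → ℕ × ℕ → List (ℕ × ℕ)) (x : ℕ × ℕ) : ℝ :=
  𝔼 t : T.nodes → T.nodes,
    ((Finset.univ.filter fun v : T.nodes => x ∈ path v (t v)).card : ℝ)

/-- The congestion: the maximum over all nodes of the expected number of searches that visit the
node, divided by the total number `N` of searches. -/
noncomputable def congestion (k : Routing) : ℝ :=
  ⨆ x : T.nodes, T.expectedVisits (T.search k) x / T.N

end D2Tree

/-!
A pair of a source and a target leads the horizontal search in a row of `M` nodes from a position
`p` to a position `q`. With routing tables the path depends, up to a translation, only on the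
displacement `q - p`, and it has `O(log M)` nodes. So for each of the `O(M)` displacements a given
position is visited from `O(log M)` starting points, hence by `O(M log M)` pairs `(p, q)`.
With hypernodes, the link of a node of rank `i` passes a number of hypernodes that depends on `i`
only, and the search makes change greedily for the number of hypernodes to be passed. A coin is met
with at most three amounts left to pay, whence again a bound of `O(M log M)` pairs.

The horizontal phase stops at the target, or at an ancestor or a descendant of it. As the buckets
are balanced, only `O(N / M)` targets make it stop at a given node of a row of width `M`. Hence its
visits to a node come from `O(N log M)` pairs of a source and a target, and their expected number is
`O(log M)`.

If the vertical phase visits `x`, then the horizontal phase stops, or the target lies, at `x` or at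
an internal node to which `x` is adjacent, in order, within its row; or else the search descends to
`x` or through it, so that the target is below the tree node of `x` and the source is in its row or
above. The number of such sources times the number of such targets is `O(N)`.
-/

/-! ### Walks -/

/-- `l` lists the vertices of a walk from `a` to `b` along the relation `R`; `D2Tree.IsPath` is the
case of the relation `D2Tree.Link`. -/
def IsWalk {α : Type*} (R : α → α → Prop) (a b : α) (l : List α) : Prop :=
  l.head? = some a ∧ l.getLast? = some b ∧ l.IsChain R

namespace IsWalk

variable {α β : Type*} {R S : α → α → Prop} {a b c d : α} {l l' : List α}

theorem singleton (a : α) : IsWalk R a a [a] := ⟨rfl, rfl, .singleton _⟩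

theorem append (h : IsWalk R a b l) (h' : IsWalk R c d l') (hbc : R b c) :
    IsWalk R a d (l ++ l') := by
  refine ⟨by simp [h.1], by simp [h'.2.1], List.isChain_append.2 ⟨h.2.2, h'.2.2, ?_⟩⟩
  rw [h.2.1, h'.1]
  rintro x ⟨⟩ y ⟨⟩
  exact hbc

theorem cons (hab : R a b) (h : IsWalk R b c l) : IsWalk R a c (a :: l) :=
  (singleton a).append h hab

theorem trans (h : IsWalk R a b l) (h' : IsWalk R b c l') : IsWalk R a c (l ++ l'.tail) := by
  obtain ⟨t, rfl⟩ := List.head?_eq_some_iff.1 h'.1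
  cases t with
  | nil =>
    obtain rfl : b = c := by simpa using h'.2.1
    simpa using h
  | cons x t =>
    obtain ⟨hbx, hchain⟩ := List.isChain_cons_cons.1 h'.2.2
    exact h.append ⟨rfl, by simpa using h'.2.1, hchain⟩ hbx

theorem imp (h : IsWalk R a b l) (hRS : ∀ x y, R x y → S x y) : IsWalk S a b l :=
  ⟨h.1, h.2.1, h.2.2.imp hRS⟩

theorem reverse (h : IsWalk R a b l) (hR : ∀ x y, R x y → R y x) : IsWalk R b a l.reverse :=
  ⟨by simpa using h.2.1, by simpa using h.1, List.isChain_reverse.2 (h.2.2.imp hR)⟩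

theorem map {S : β → β → Prop} (f : α → β) (h : IsWalk R a b l)
    (hf : ∀ x y, R x y → S (f x) (f y)) : IsWalk S (f a) (f b) (l.map f) :=
  ⟨by simp [h.1], by simp [h.2.1], (List.isChain_map f).2 (h.2.2.imp hf)⟩

theorem map_range (f : ℕ → α) (n : ℕ) (hf : ∀ j < n, R (f j) (f (j + 1))) :
    IsWalk R (f 0) (f n) ((List.range (n + 1)).map f) := by
  refine ⟨by simp [List.range_succ_eq_map], by simp [List.range_succ], ?_⟩
  rw [List.isChain_map, List.isChain_range]
  exact fun j hj ↦ hf j (by omega)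

end IsWalk

namespace Row

open Finset

section Follow

variable {step : ℕ → ℕ} {q : ℕ} {P : ℕ → Prop}

theorem forall_mem_follow (hP : ∀ c, P c → c ≠ q → P (step c)) {fuel c : ℕ} (hc : P c) :
    ∀ x ∈ follow step q fuel c, P x := by
  induction fuel generalizing c with
  | zero => simpa [follow] using hc
  | succ n ih =>
    rw [follow]
    split_ifs with h
    · simpa using hc
    · exact List.forall_mem_cons.2 ⟨hc, ih (hP c hc h)⟩

theorem isWalk_follow {R : ℕ → ℕ → Prop} (μ : ℕ → ℕ) (hP : ∀ c, P c → c ≠ q → P (step c))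
    (hμ : ∀ c, P c → c ≠ q → μ (step c) < μ c) (hR : ∀ c, P c → c ≠ q → R c (step c))
    {fuel c : ℕ} (hc : P c) (hfuel : μ c ≤ fuel) : IsWalk R c q (follow step q fuel c) := by
  induction fuel generalizing c with
  | zero =>
    obtain rfl : c = q := by
      by_contra h
      exact absurd (hμ c hc h) (by omega)
    exact .singleton _
  | succ n ih =>
    rw [follow]
    split_ifs with h
    · exact h ▸ .singleton c
    · have := hμ c hc h
      exact .cons (hR c hc h) (ih (hP c hc h) (by omega))

end Follow

/-- The number of pairs of a source and a destination in a row of `M` nodes for which the search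
visits the position `c`. -/
def routeCount (k : Routing) (M c : ℕ) : ℕ :=
  #{pq ∈ range M ×ˢ range M | c ∈ route k M pq.1 pq.2}

/-! ### Routing tables -/

lemma dist_tableStep_add_two_pow {q c : ℕ} (h : c ≠ q) :
    Nat.dist (tableStep q c) q + 2 ^ Nat.log 2 (Nat.dist c q) = Nat.dist c q := by
  rcases h.lt_or_gt with hcq | hqc
  · have hle := Nat.pow_log_le_self 2 (Nat.sub_ne_zero_of_lt hcq)
    rw [Nat.dist_eq_sub_of_le hcq.le, tableStep, if_pos hcq, Nat.dist_eq_sub_of_le (by omega)]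
    omega
  · have hle := Nat.pow_log_le_self 2 (Nat.sub_ne_zero_of_lt hqc)
    rw [Nat.dist_eq_sub_of_le_right hqc.le, tableStep, if_neg (by omega),
      Nat.dist_eq_sub_of_le_right (by omega)]
    omega

lemma dist_tableStep_lt {q c : ℕ} (h : c ≠ q) : Nat.dist (tableStep q c) q < Nat.dist c q := by
  have := dist_tableStep_add_two_pow h
  have := Nat.two_pow_pos (Nat.log 2 (Nat.dist c q))
  omega

lemma dist_tableStep_lt_two_pow {q c : ℕ} (h : c ≠ q) :
    Nat.dist (tableStep q c) q < 2 ^ Nat.log 2 (Nat.dist c q) := by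
  have := dist_tableStep_add_two_pow h
  have hlt := Nat.lt_pow_succ_log_self one_lt_two (Nat.dist c q)
  rw [pow_succ] at hlt
  omega

lemma tableStep_lt {M q c : ℕ} (hq : q < M) (hc : c < M) : tableStep q c < M := by
  unfold tableStep
  split_ifs with h
  · have := Nat.pow_log_le_self 2 (Nat.sub_ne_zero_of_lt h)
    omega
  · exact (Nat.sub_le _ _).trans_lt hc

lemma link_tableStep {M q c : ℕ} (hq : q < M) (hc : c < M) (h : c ≠ q) :
    Link .table M c (tableStep q c) := by
  unfold tableStep
  split_ifs with hcq
  · have := Nat.pow_log_le_self 2 (Nat.sub_ne_zero_of_lt hcq)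
    exact ⟨_, (Nat.lt_clog_iff_pow_lt one_lt_two).2 (by omega), .inl rfl⟩
  · have := Nat.pow_log_le_self 2 (x := c - q) (by omega)
    exact ⟨Nat.log 2 (c - q), (Nat.lt_clog_iff_pow_lt one_lt_two).2 (by omega),
      .inr (by omega)⟩

theorem isWalk_route_table {M p q : ℕ} (hp : p < M) (hq : q < M) :
    IsWalk (fun c d ↦ c < M ∧ d < M ∧ Link .table M c d) p q (route .table M p q) := by
  refine isWalk_follow (P := (· < M)) (Nat.dist · q) (fun _ hc _ ↦ tableStep_lt hq hc)
    (fun _ _ h ↦ dist_tableStep_lt h)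
    (fun c hc h ↦ ⟨hc, tableStep_lt hq hc, link_tableStep hq hc h⟩) hp ?_
  simp only [Nat.dist]
  omega

lemma length_follow_tableStep_le {q fuel c k : ℕ} (h : Nat.dist c q < 2 ^ k) :
    (follow (tableStep q) q fuel c).length ≤ k + 1 := by
  induction fuel generalizing c k with
  | zero => simp [follow]
  | succ n ih =>
    rw [follow]
    split_ifs with hc
    · simp
    · have hdist : Nat.dist c q ≠ 0 := fun h0 ↦ hc (Nat.eq_of_dist_eq_zero h0)
      have hlog : Nat.log 2 (Nat.dist c q) < k := Nat.log_lt_of_lt_pow hdist h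
      have hlen := ih (dist_tableStep_lt_two_pow hc)
      rw [List.length_cons]
      omega

lemma length_route_table_le {M p q : ℕ} (hp : p < M) (hq : q < M) :
    (route .table M p q).length ≤ Nat.clog 2 M + 1 := by
  refine length_follow_tableStep_le (lt_of_lt_of_le ?_ (Nat.le_pow_clog one_lt_two M))
  simp only [Nat.dist]
  omega

lemma tableStep_add_right {q c : ℕ} (x : ℕ) (h : c ≠ q) :
    tableStep (q + x) (c + x) = tableStep q c + x := by
  simp only [tableStep, add_lt_add_iff_right, Nat.add_sub_add_right]
  split_ifs with hcq
  · omega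
  · have := Nat.pow_log_le_self 2 (x := c - q) (by omega)
    omega

lemma route_table_add_right (M p q x : ℕ) :
    route .table M (p + x) (q + x) = (route .table M p q).map (· + x) := by
  suffices ∀ fuel c, follow (tableStep (q + x)) (q + x) fuel (c + x) =
      (follow (tableStep q) q fuel c).map (· + x) from this M p
  intro fuel c
  induction fuel generalizing c with
  | zero => simp [follow]
  | succ n ih =>
    simp only [follow, add_left_inj]
    split_ifs with h
    · simp
    · simp [tableStep_add_right x h, ih]

lemma card_filter_mem_map_add_le_length (A : Finset ℕ) (l : List ℕ) (c : ℕ) :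
    #{x ∈ A | c ∈ l.map (· + x)} ≤ l.length := by
  refine (card_le_card_of_injOn (c - ·) (t := l.toFinset) ?_ ?_).trans l.toFinset_card_le
  · intro x hx
    obtain ⟨y, hy, rfl⟩ := List.mem_map.1 (mem_filter.1 hx).2
    simpa using hy
  · intro x hx y hy hxy
    obtain ⟨x', -, hx'⟩ := List.mem_map.1 (mem_filter.1 hx).2
    obtain ⟨y', -, hy'⟩ := List.mem_map.1 (mem_filter.1 hy).2
    dsimp only at hxy hx' hy'
    omega

lemma card_translates_route_table_le {M p q : ℕ} (hp : p < M) (hq : q < M) (c : ℕ) :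
    #{x ∈ range M | c ∈ route .table M (p + x) (q + x)} ≤ Nat.clog 2 M + 1 := by
  simp only [route_table_add_right]
  exact (card_filter_mem_map_add_le_length _ _ _).trans (length_route_table_le hp hq)

theorem routeCount_table_le (M c : ℕ) : routeCount .table M c ≤ 2 * (M * (Nat.clog 2 M + 1)) := by
  let toRight : Finset (ℕ × ℕ) := (range M).biUnion fun t ↦
    {x ∈ range M | c ∈ route .table M (0 + x) (t + x)}.image fun x ↦ (x, t + x)
  let toLeft : Finset (ℕ × ℕ) := (range M).biUnion fun t ↦
    {x ∈ range M | c ∈ route .table M (t + x) (0 + x)}.image fun x ↦ (t + x, x)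
  have hright : #toRight ≤ M * (Nat.clog 2 M + 1) := by
    refine (card_biUnion_le_card_mul _ _ _ fun t ht ↦ card_image_le.trans
      (card_translates_route_table_le ?_ (mem_range.1 ht) c)).trans_eq (by rw [card_range])
    exact (Nat.zero_le t).trans_lt (mem_range.1 ht)
  have hleft : #toLeft ≤ M * (Nat.clog 2 M + 1) := by
    refine (card_biUnion_le_card_mul _ _ _ fun t ht ↦ card_image_le.trans
      (card_translates_route_table_le (mem_range.1 ht) ?_ c)).trans_eq (by rw [card_range])
    exact (Nat.zero_le t).trans_lt (mem_range.1 ht)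
  have hsub : {pq ∈ range M ×ˢ range M | c ∈ route .table M pq.1 pq.2} ⊆ toRight ∪ toLeft := by
    rintro ⟨p, q⟩ h
    simp only [mem_filter, mem_product, mem_range] at h
    simp only [toRight, toLeft, mem_union, mem_biUnion, mem_image, mem_filter, mem_range,
      Prod.mk.injEq, zero_add]
    rcases le_total p q with hpq | hqp
    · exact .inl ⟨q - p, by omega, p, ⟨h.1.1, by rw [Nat.sub_add_cancel hpq]; exact h.2⟩, by omega⟩
    · exact .inr ⟨p - q, by omega, q, ⟨h.1.2, by rw [Nat.sub_add_cancel hqp]; exact h.2⟩, by omega⟩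
  calc routeCount .table M c ≤ #(toRight ∪ toLeft) := card_le_card hsub
    _ ≤ #toRight + #toLeft := card_union_le _ _
    _ ≤ 2 * (M * (Nat.clog 2 M + 1)) := by omega

/-! ### Greedy change making -/

/-- A system of coins `1, …, s` with values `e 1, …, e s` for which greedy change making, from the
coin `s` downwards, uses every coin at most twice. -/
structure CoinSystem (e : ℕ → ℕ) (s : ℕ) : Prop where
  one_le : 1 ≤ s
  first_le : e 1 ≤ 1
  succ_le : ∀ i, 1 ≤ i → i < s → e (i + 1) ≤ 2 * e i + 1
  one_le_last : 1 ≤ e s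

/-- What remains of the amount `t` modulo the values of the coins `s, s - 1, …, s - k`, in turn. -/
def residue (e : ℕ → ℕ) (s t : ℕ) : ℕ → ℕ
  | 0 => t % e s
  | k + 1 => residue e s t k % e (s - (k + 1))

/-- Greedy change making for the amount `t` may be at the coin `i` with the amount `d` left to pay.
The residue determines `d` up to the number of coins `i` still to be used, so that a coin is met
with few different amounts. -/
structure GreedyState (e : ℕ → ℕ) (s t i d : ℕ) : Prop where
  one_le : 1 ≤ i
  le : i ≤ s
  one_le_coin : 1 ≤ e i
  le_two_mul : d ≤ 2 * e i
  mod_eq : d % e i = residue e s t (s - i)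

section Greedy

variable {e : ℕ → ℕ} {s t i d : ℕ}

lemma CoinSystem.greedyState_start (he : CoinSystem e s) (ht : t ≤ e s) :
    GreedyState e s t s t where
  one_le := he.one_le
  le := le_rfl
  one_le_coin := he.one_le_last
  le_two_mul := by omega
  mod_eq := by rw [Nat.sub_self, residue]

lemma GreedyState.pay (h : GreedyState e s t i d) (hd : e i ≤ d) :
    GreedyState e s t i (d - e i) where
  one_le := h.one_le
  le := h.le
  one_le_coin := h.one_le_coin
  le_two_mul := (Nat.sub_le _ _).trans h.le_two_mul
  mod_eq := by rw [← h.mod_eq, Nat.mod_eq_sub_mod hd]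

lemma GreedyState.two_le (h : GreedyState e s t i d) (he : CoinSystem e s) (hpos : 0 < d)
    (hd : d < e i) : 2 ≤ i := by
  have := h.one_le
  have := he.first_le
  by_contra hi
  obtain rfl : i = 1 := by omega
  omega

lemma GreedyState.lower (h : GreedyState e s t i d) (he : CoinSystem e s) (hpos : 0 < d)
    (hd : d < e i) : GreedyState e s t (i - 1) d := by
  have := h.two_le he hpos hd
  obtain ⟨j, rfl⟩ : ∃ j, i = j + 1 := ⟨i - 1, by omega⟩
  have hjs := h.le
  have := he.succ_le j (by omega) (by omega)
  rw [Nat.add_sub_cancel]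
  refine ⟨by omega, by omega, by omega, by omega, ?_⟩
  rw [show s - j = s - (j + 1) + 1 by omega, residue, ← h.mod_eq, Nat.mod_eq_of_lt hd,
    show s - (s - (j + 1) + 1) = j by omega]

lemma card_greedyState_le (D : Finset ℕ) (hD : ∀ d ∈ D, GreedyState e s t i d) : #D ≤ 3 := by
  refine (card_le_card_of_injOn (· / e i) (t := range 3) ?_ ?_).trans (card_range 3).le
  · intro d hd
    have h := hD d hd
    simp only [coe_range, Set.mem_Iio]
    rw [Nat.div_lt_iff_lt_mul h.one_le_coin]
    have := h.one_le_coin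
    have := h.le_two_mul
    omega
  · intro d hd d' hd' hdiv
    dsimp only at hdiv
    rw [← Nat.mod_add_div d (e i), ← Nat.mod_add_div d' (e i), hdiv, (hD d hd).mod_eq,
      (hD d' hd').mod_eq]

end Greedy

lemma coinSystem_div {x : ℕ → ℕ} {s : ℕ} (hs : 1 ≤ s) (hfirst : x 1 < 2 * s)
    (hsucc : ∀ i, 1 ≤ i → i < s → x (i + 1) ≤ 2 * x i + 1) (hlast : s ≤ x s) :
    CoinSystem (fun i ↦ x i / s) s where
  one_le := hs
  first_le := Nat.le_of_lt_succ ((Nat.div_lt_iff_lt_mul hs).2 hfirst)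
  succ_le i hi his := by
    refine Nat.le_of_lt_succ ((Nat.div_lt_iff_lt_mul hs).2 ?_)
    have hlt := Nat.lt_mul_div_succ (x i) hs
    calc x (i + 1) ≤ 2 * x i + 1 := hsucc i hi his
      _ < 2 * (s * (x i / s + 1)) := by omega
      _ = (2 * (x i / s) + 1).succ * s := by rw [Nat.succ_eq_add_one]; ring
  one_le_last := (Nat.one_le_div_iff hs).2 hlast

/-- The number of hypernodes (of size `s`) passed by the right link of a node of rank `i`. -/
def rightCoin (s i : ℕ) : ℕ := (2 ^ i + (i - 1)) / s

/-- The number of hypernodes (of size `s`) passed by the left link of a node of rank `i`. -/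
def leftCoin (s i : ℕ) : ℕ := (2 ^ i + (s - i)) / s

lemma coinSystem_rightCoin {s : ℕ} (hs : 2 ≤ s) : CoinSystem (rightCoin s) s := by
  refine coinSystem_div (by omega) (by omega) (fun i hi _ ↦ ?_) ?_
  · rw [pow_succ]
    omega
  · have := Nat.lt_two_pow_self (n := s)
    omega

lemma coinSystem_leftCoin {s : ℕ} (hs : 2 ≤ s) : CoinSystem (leftCoin s) s := by
  refine coinSystem_div (by omega) (by omega) (fun i _ hi ↦ ?_) ?_
  · rw [pow_succ]
    omega
  · have := Nat.lt_two_pow_self (n := s)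
    omega

/-! ### Hypernodes -/

section Hypernodes

variable {M c d : ℕ}

lemma two_le_hyperSize (M : ℕ) : 2 ≤ hyperSize M := le_max_right _ _

lemma hyperSize_pos (M : ℕ) : 0 < hyperSize M := two_pos.trans_le (two_le_hyperSize M)

lemma le_two_pow_hyperSize (M : ℕ) : M ≤ 2 ^ hyperSize M :=
  (Nat.le_pow_clog one_lt_two M).trans (Nat.pow_le_pow_right two_pos (le_max_left _ _))

lemma hyperSize_le (hM : 2 ≤ M) : hyperSize M ≤ M :=
  max_le (Nat.clog_le_of_le_pow Nat.lt_two_pow_self.le) hM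

lemma hyperSize_le_clog_add_two (M : ℕ) : hyperSize M ≤ Nat.clog 2 M + 2 :=
  max_le (by omega) (by omega)

lemma one_le_rank (M c : ℕ) : 1 ≤ rank M c := Nat.succ_pos _

lemma rank_le (M c : ℕ) : rank M c ≤ hyperSize M := Nat.mod_lt _ (hyperSize_pos M)

lemma hyperOf_mul_add_rank (M c : ℕ) : hyperOf M c * hyperSize M + rank M c = c + 1 := by
  rw [hyperOf, rank, ← add_assoc, Nat.div_add_mod']

lemma hyperOf_eq_iff {h : ℕ} :
    hyperOf M c = h ↔ h * hyperSize M ≤ c ∧ c < h * hyperSize M + hyperSize M := by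
  rw [hyperOf, Nat.div_eq_iff (hyperSize_pos M)]
  have := hyperSize_pos M
  omega

lemma rank_eq {h r : ℕ} (hpos : 1 ≤ r) (hle : r ≤ hyperSize M) (hc : c + 1 = h * hyperSize M + r) :
    rank M c = r := by
  have hh : hyperOf M c = h := hyperOf_eq_iff.2 (by omega)
  have := hyperOf_mul_add_rank M c
  rw [hh] at this
  omega

lemma hyperOf_le (hc : c < M) : hyperOf M c ≤ (M - 1) / hyperSize M :=
  Nat.div_le_div_right (by omega)

lemma hyperOf_lt (hc : c < M) : hyperOf M c < M / hyperSize M + 1 :=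
  Nat.lt_succ_of_le (Nat.div_le_div_right hc.le)

lemma hyperOf_pred (h : 2 ≤ rank M c) : hyperOf M (c - 1) = hyperOf M c := by
  have := hyperOf_mul_add_rank M c
  have := rank_le M c
  exact hyperOf_eq_iff.2 (by omega)

lemma rank_pred (h : 2 ≤ rank M c) : rank M (c - 1) = rank M c - 1 := by
  have := hyperOf_mul_add_rank M c
  have := rank_le M c
  exact rank_eq (h := hyperOf M c) (by omega) (by omega) (by omega)

lemma dist_lt_of_hyperOf_eq (h : hyperOf M c = hyperOf M d) : Nat.dist c d < hyperSize M := by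
  have hc := hyperOf_eq_iff.1 h
  have hd := hyperOf_eq_iff.1 (rfl : hyperOf M d = hyperOf M d)
  simp only [Nat.dist]
  omega

lemma rightHyper_eq (M c : ℕ) :
    rightHyper M c = hyperOf M c + rightCoin (hyperSize M) (rank M c) := by
  have := hyperOf_mul_add_rank M c
  have := one_le_rank M c
  have hc : c + 2 ^ rank M c = 2 ^ rank M c + (rank M c - 1) + hyperOf M c * hyperSize M := by omega
  rw [rightHyper, hyperOf.eq_def M (c + _), hc, Nat.add_mul_div_right _ _ (hyperSize_pos M),
    rightCoin, add_comm]

lemma two_pow_rank_le_iff (M c : ℕ) :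
    2 ^ rank M c ≤ c ↔ leftCoin (hyperSize M) (rank M c) ≤ hyperOf M c := by
  have := hyperOf_mul_add_rank M c
  have := rank_le M c
  rw [leftCoin, ← Nat.lt_succ_iff (n := hyperOf M c), Nat.div_lt_iff_lt_mul (hyperSize_pos M),
    Nat.succ_mul]
  omega

lemma leftHyper_eq (h : 2 ^ rank M c ≤ c) :
    leftHyper M c = hyperOf M c - leftCoin (hyperSize M) (rank M c) := by
  have hc := hyperOf_mul_add_rank M c
  have hrank := rank_le M c
  have hle : leftCoin (hyperSize M) (rank M c) * hyperSize M ≤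
      2 ^ rank M c + (hyperSize M - rank M c) := Nat.div_mul_le_self _ _
  have hlt : 2 ^ rank M c + (hyperSize M - rank M c) <
      leftCoin (hyperSize M) (rank M c) * hyperSize M + hyperSize M := by
    rw [← Nat.succ_mul, mul_comm]
    exact Nat.lt_mul_div_succ _ (hyperSize_pos M)
  have := Nat.mul_le_mul_right (hyperSize M) ((two_pow_rank_le_iff M c).1 h)
  exact hyperOf_eq_iff.2 (by rw [Nat.sub_mul]; omega)

lemma hyperOf_leftEnd (M c : ℕ) : hyperOf M (leftEnd M c) = leftHyper M c := by
  have := one_le_rank M c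
  have := rank_le M c
  exact hyperOf_eq_iff.2 (by unfold leftEnd; omega)

lemma rank_leftEnd (M c : ℕ) : rank M (leftEnd M c) = rank M c := by
  have := one_le_rank M c
  exact rank_eq (h := leftHyper M c) this (rank_le M c) (by unfold leftEnd; omega)

lemma leftEnd_le (M c : ℕ) : leftEnd M c ≤ c := by
  have hle : leftHyper M c ≤ hyperOf M c := Nat.div_le_div_right (Nat.sub_le _ _)
  have := Nat.mul_le_mul_right (hyperSize M) hle
  have := hyperOf_mul_add_rank M c
  have := one_le_rank M c
  unfold leftEnd
  omega

lemma rightEnd_of_lt (h : hyperOf M c < rightHyper M c) :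
    rightEnd M c = min (rightHyper M c * hyperSize M + (rank M c - 1)) (M - 1) := by
  rw [rightEnd, if_neg h.ne']

lemma hyperOf_rightEnd (h : hyperOf M c < rightHyper M c) (hM : rightHyper M c * hyperSize M < M) :
    hyperOf M (rightEnd M c) = rightHyper M c := by
  have := rank_le M c
  have := one_le_rank M c
  exact hyperOf_eq_iff.2 (by rw [rightEnd_of_lt h]; omega)

lemma rank_rightEnd (h : hyperOf M c < rightHyper M c)
    (hM : (rightHyper M c + 1) * hyperSize M < M) : rank M (rightEnd M c) = rank M c := by
  have := rank_le M c
  have := one_le_rank M c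
  rw [Nat.succ_mul] at hM
  exact rank_eq (h := rightHyper M c) (by omega) (by omega) (by rw [rightEnd_of_lt h]; omega)

lemma top_add_one (c : ℕ) (hM : 2 ≤ M) :
    (top M c + 1 = hyperOf M c * hyperSize M + hyperSize M ∧ top M c < M) ∨
      (1 ≤ hyperOf M c ∧ top M c + 1 = hyperOf M c * hyperSize M) := by
  have := hyperSize_pos M
  unfold top
  split_ifs with hcomplete hfirst
  · rw [Nat.succ_mul] at *
    omega
  · rw [hfirst, Nat.succ_mul] at hcomplete
    have := hyperSize_le hM
    omega
  · have : hyperSize M ≤ hyperOf M c * hyperSize M := Nat.le_mul_of_pos_left _ (by omega)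
    omega

lemma top_lt (hM : 2 ≤ M) (hc : c < M) : top M c < M := by
  have := hyperOf_mul_add_rank M c
  have := one_le_rank M c
  rcases top_add_one c hM with h | h <;> omega

lemma rank_top (hM : 2 ≤ M) : rank M (top M c) = hyperSize M := by
  have hs := hyperSize_pos M
  rcases top_add_one c hM with ⟨h, -⟩ | ⟨hpos, h⟩
  · exact rank_eq hs le_rfl h
  · obtain ⟨k, hk⟩ := Nat.exists_eq_add_of_le' hpos
    rw [hk, Nat.succ_mul] at h
    exact rank_eq hs le_rfl h

lemma hyperOf_top (hM : 2 ≤ M) :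
    hyperOf M c = hyperOf M (top M c) ∨ hyperOf M c = hyperOf M (top M c) + 1 := by
  have hs := hyperSize_pos M
  rcases top_add_one c hM with ⟨h, -⟩ | ⟨hpos, h⟩
  · exact .inl (hyperOf_eq_iff.2 (by omega)).symm
  · obtain ⟨k, hk⟩ := Nat.exists_eq_add_of_le' hpos
    rw [hk, Nat.succ_mul] at h
    have htop : hyperOf M (top M c) = k := hyperOf_eq_iff.2 (by omega)
    exact .inr (by rw [hk, htop])

lemma card_filter_hyperOf_le (M h : ℕ) : #{c ∈ range M | hyperOf M c = h} ≤ hyperSize M := by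
  have hsub : {c ∈ range M | hyperOf M c = h} ⊆
      Ico (h * hyperSize M) (h * hyperSize M + hyperSize M) := fun c hc ↦
    mem_Ico.2 (hyperOf_eq_iff.1 (mem_filter.1 hc).2)
  simpa using card_le_card hsub

lemma card_filter_hyperOf_top_le (hM : 2 ≤ M) (h : ℕ) :
    #{c ∈ range M | hyperOf M (top M c) = h} ≤ 2 * hyperSize M := by
  have hsub : {c ∈ range M | hyperOf M (top M c) = h} ⊆
      {c ∈ range M | hyperOf M c = h} ∪ {c ∈ range M | hyperOf M c = h + 1} := by
    intro c hc
    obtain ⟨hcM, rfl⟩ := mem_filter.1 hc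
    simpa [mem_range.1 hcM] using hyperOf_top (c := c) hM
  have := card_filter_hyperOf_le M h
  have := card_filter_hyperOf_le M (h + 1)
  have := (card_le_card hsub).trans (card_union_le _ _)
  omega

end Hypernodes

/-! ### Searches with hypernodes -/

variable {M Q g c q p : ℕ}

/-- The search for a node of the hypernode `Q`, whose first node of highest rank is in the hypernode
`g`, may be at the position `c` while it still moves to the right towards `Q`. In units of
hypernodes the link of a node is a coin whose value only depends on the rank, and the search makes
change for the amount `Q - g`. -/
structure RightState (M Q g c : ℕ) : Prop where
  lt : hyperOf M c < Q
  le : g ≤ Q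
  greedy : GreedyState (rightCoin (hyperSize M)) (hyperSize M) (Q - g) (rank M c) (Q - hyperOf M c)

/-- The analogue of `RightState` for a search that moves to the left. -/
structure LeftState (M Q g c : ℕ) : Prop where
  lt : Q < hyperOf M c
  le : Q ≤ g
  greedy : GreedyState (leftCoin (hyperSize M)) (hyperSize M) (g - Q) (rank M c) (hyperOf M c - Q)

/-- The positions that a search for `q` whose first node of highest rank is in the hypernode `g` may
visit from that node on. -/
def HyperState (M q g c : ℕ) : Prop :=
  c < M ∧ (hyperOf M c = hyperOf M q ∨ RightState M (hyperOf M q) g c ∨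
    LeftState M (hyperOf M q) g c)

lemma hyperState_top (hM : 2 ≤ M) (hp : p < M) (hq : q < M) :
    HyperState M q (hyperOf M (top M p)) (top M p) := by
  have hs := two_le_hyperSize M
  have hpow := le_two_pow_hyperSize M
  have htop := hyperOf_le (top_lt hM hp)
  have hqM := hyperOf_le hq
  refine ⟨top_lt hM hp, ?_⟩
  rcases lt_trichotomy (hyperOf M (top M p)) (hyperOf M q) with h | h | h
  · refine .inr (.inl ⟨h, h.le, ?_⟩)
    rw [rank_top hM]
    exact (coinSystem_rightCoin hs).greedyState_start
      (((Nat.sub_le _ _).trans hqM).trans (Nat.div_le_div_right (by omega)))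
  · exact .inl h
  · refine .inr (.inr ⟨h, h.le, ?_⟩)
    rw [rank_top hM]
    exact (coinSystem_leftCoin hs).greedyState_start
      (((Nat.sub_le _ _).trans htop).trans (Nat.div_le_div_right (by omega)))

/-- An upper bound for the number of steps that a search with hypernodes for `q` takes from `c`. -/
def hyperMeasure (M q c : ℕ) : ℕ :=
  if hyperOf M c = hyperOf M q then Nat.dist c q
  else Nat.dist (hyperOf M c) (hyperOf M q) + rank M c + hyperSize M

lemma hyperMeasure_lt_of_dist_lt {d : ℕ} (hc : hyperOf M c ≠ hyperOf M q)
    (hd : Nat.dist (hyperOf M d) (hyperOf M q) < Nat.dist (hyperOf M c) (hyperOf M q))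
    (hrank : hyperOf M d ≠ hyperOf M q → rank M d = rank M c) :
    hyperMeasure M q d < hyperMeasure M q c := by
  rw [hyperMeasure, hyperMeasure, if_neg hc]
  split_ifs with h
  · have := dist_lt_of_hyperOf_eq h
    omega
  · rw [hrank h]
    omega

lemma hyperMeasure_pred_lt (hc : hyperOf M c ≠ hyperOf M q) (h : 2 ≤ rank M c) :
    hyperMeasure M q (c - 1) < hyperMeasure M q c := by
  rw [hyperMeasure, hyperMeasure, hyperOf_pred h, if_neg hc, if_neg hc, rank_pred h]
  omega

lemma hyperMeasure_le (hM : 2 ≤ M) (hc : c < M) (hq : q < M) :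
    hyperMeasure M q c ≤ 4 * M + 4 := by
  have hs := hyperSize_le hM
  have hhc : hyperOf M c ≤ c := Nat.div_le_self _ _
  have hhq : hyperOf M q ≤ q := Nat.div_le_self _ _
  have hrank := rank_le M c
  unfold hyperMeasure Nat.dist
  split_ifs <;> omega

/-- A step from `c` to `d` that keeps the search for `q` in its states, brings it closer to `q` and
follows a link. -/
structure IsAdvance (M q g c d : ℕ) : Prop where
  state : HyperState M q g d
  measure_lt : hyperMeasure M q d < hyperMeasure M q c
  link : Link .hyper M c d

lemma isAdvance_of_hyperOf_eq {d : ℕ} (hq : q < M) (hcM : c < M) (hc : hyperOf M c = hyperOf M q)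
    (hd : d = c + 1 ∧ c < q ∨ c = d + 1 ∧ q < c) : IsAdvance M q g c d := by
  have hcb := hyperOf_eq_iff.1 hc
  have hqb := hyperOf_eq_iff.1 (rfl : hyperOf M q = hyperOf M q)
  have hdq : hyperOf M d = hyperOf M q := hyperOf_eq_iff.2 (by omega)
  refine ⟨⟨by omega, .inl hdq⟩, ?_, .inl ⟨hc.trans hdq.symm, by omega⟩⟩
  rw [hyperMeasure, hyperMeasure, if_pos hdq, if_pos hc]
  unfold Nat.dist
  omega

lemma RightState.isAdvance_rightEnd (h : RightState M (hyperOf M q) g c) (hq : q < M)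
    (hlt : hyperOf M c < rightHyper M c) (hle : rightHyper M c ≤ hyperOf M q) :
    IsAdvance M q g c (rightEnd M c) := by
  have hqb := hyperOf_eq_iff.1 (rfl : hyperOf M q = hyperOf M q)
  have hexists : rightHyper M c * hyperSize M < M :=
    (Nat.mul_le_mul_right _ hle).trans_lt (hqb.1.trans_lt hq)
  have hend := hyperOf_rightEnd hlt hexists
  have hrank (hne : hyperOf M (rightEnd M c) ≠ hyperOf M q) :
      rank M (rightEnd M c) = rank M c := by
    refine rank_rightEnd hlt ((Nat.mul_le_mul_right _ ?_).trans_lt (hqb.1.trans_lt hq))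
    omega
  refine ⟨⟨by rw [rightEnd_of_lt hlt]; omega, or_iff_not_imp_left.2 fun hne ↦ .inl ?_⟩,
    hyperMeasure_lt_of_dist_lt h.lt.ne ?_ hrank, .inr (.inr (.inl ⟨hexists, rfl⟩))⟩
  · refine ⟨by omega, h.le, ?_⟩
    have hcoin := rightHyper_eq M c
    rw [hrank hne, hend, hcoin, ← Nat.sub_sub]
    exact h.greedy.pay (by omega)
  · unfold Nat.dist
    omega

lemma LeftState.isAdvance_leftEnd (h : LeftState M (hyperOf M q) g c) (hcM : c < M)
    (hlink : 2 ^ rank M c ≤ c) (hle : hyperOf M q ≤ leftHyper M c) :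
    IsAdvance M q g c (leftEnd M c) := by
  have hend := hyperOf_leftEnd M c
  have hrank := rank_leftEnd M c
  have hcoin := leftHyper_eq hlink
  have hcoin_le := (two_pow_rank_le_iff M c).1 hlink
  have hcoin_pos := h.greedy.one_le_coin
  have hlt := h.lt
  refine ⟨⟨(leftEnd_le M c).trans_lt hcM, or_iff_not_imp_left.2 fun hne ↦ .inr ?_⟩,
    hyperMeasure_lt_of_dist_lt h.lt.ne' ?_ fun _ ↦ hrank, .inr (.inr (.inr ⟨hlink, rfl⟩))⟩
  · refine ⟨by omega, h.le, ?_⟩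
    rw [hrank, hend, hcoin, Nat.sub_right_comm]
    exact h.greedy.pay (by omega)
  · unfold Nat.dist
    omega

lemma link_pred (h : 2 ≤ rank M c) : Link .hyper M c (c - 1) := by
  have hc : rank M c ≤ c + 1 := (hyperOf_mul_add_rank M c).le.trans' (Nat.le_add_left _ _)
  exact .inl ⟨(hyperOf_pred h).symm, .inr (by omega)⟩

lemma RightState.isAdvance_pred (h : RightState M (hyperOf M q) g c) (hcM : c < M)
    (hd : hyperOf M q - hyperOf M c < rightCoin (hyperSize M) (rank M c)) :
    IsAdvance M q g c (c - 1) := by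
  have hcoin := coinSystem_rightCoin (two_le_hyperSize M)
  have hpos := Nat.sub_pos_of_lt h.lt
  have hrank := h.greedy.two_le hcoin hpos hd
  refine ⟨⟨by omega, .inr (.inl ?_)⟩, hyperMeasure_pred_lt h.lt.ne hrank, link_pred hrank⟩
  refine ⟨by rw [hyperOf_pred hrank]; exact h.lt, h.le, ?_⟩
  rw [hyperOf_pred hrank, rank_pred hrank]
  exact h.greedy.lower hcoin hpos hd

lemma LeftState.isAdvance_pred (h : LeftState M (hyperOf M q) g c) (hcM : c < M)
    (hd : hyperOf M c - hyperOf M q < leftCoin (hyperSize M) (rank M c)) :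
    IsAdvance M q g c (c - 1) := by
  have hcoin := coinSystem_leftCoin (two_le_hyperSize M)
  have hpos := Nat.sub_pos_of_lt h.lt
  have hrank := h.greedy.two_le hcoin hpos hd
  refine ⟨⟨by omega, .inr (.inr ?_)⟩, hyperMeasure_pred_lt h.lt.ne' hrank, link_pred hrank⟩
  refine ⟨by rw [hyperOf_pred hrank]; exact h.lt, h.le, ?_⟩
  rw [hyperOf_pred hrank, rank_pred hrank]
  exact h.greedy.lower hcoin hpos hd

lemma HyperState.isAdvance_hyperStep (h : HyperState M q g c) (hq : q < M) (hne : c ≠ q) :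
    IsAdvance M q g c (hyperStep M q c) := by
  obtain ⟨hcM, hc | hright | hleft⟩ := h
  · rw [hyperStep, if_pos hc]
    refine isAdvance_of_hyperOf_eq hq hcM hc ?_
    split_ifs <;> omega
  · rw [hyperStep, if_neg hright.lt.ne, if_pos hright.lt]
    split_ifs with hlink
    · exact hright.isAdvance_rightEnd hq hlink.1 hlink.2
    · have := hright.greedy.one_le_coin
      rw [rightHyper_eq] at hlink
      exact hright.isAdvance_pred hcM (by omega)
  · rw [hyperStep, if_neg hleft.lt.ne', if_neg hleft.lt.not_gt]
    split_ifs with hlink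
    · exact hleft.isAdvance_leftEnd hcM hlink.1 hlink.2
    · refine hleft.isAdvance_pred hcM ?_
      by_contra hcoin
      have hlt := hleft.lt
      have hpow := (two_pow_rank_le_iff M c).2 (by omega)
      have hhyper := leftHyper_eq hpow
      exact hlink ⟨hpow, by omega⟩

theorem isWalk_route_hyper (hp : p < M) (hq : q < M) :
    IsWalk (fun c d ↦ c < M ∧ d < M ∧ Link .hyper M c d) p q (route .hyper M p q) := by
  simp only [route]
  split_ifs with hpq htop
  · exact hpq ▸ .singleton p
  all_goals
    have hM : 2 ≤ M := by omega
    have hstart := hyperState_top hM hp hq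
    have hwalk : IsWalk (fun c d ↦ c < M ∧ d < M ∧ Link .hyper M c d) (top M p) q
        (follow (hyperStep M q) q (4 * M + 4) (top M p)) :=
      isWalk_follow (hyperMeasure M q) (fun c hc hne ↦ (hc.isAdvance_hyperStep hq hne).state)
        (fun c hc hne ↦ (hc.isAdvance_hyperStep hq hne).measure_lt)
        (fun c hc hne ↦ have hstep := hc.isAdvance_hyperStep hq hne
          ⟨hc.1, hstep.state.1, hstep.link⟩) hstart (hyperMeasure_le hM hstart.1 hq)
  · rwa [← htop] at hwalk
  · exact .cons ⟨hp, hstart.1, .inr (.inl rfl)⟩ hwalk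

lemma eq_or_hyperState_of_mem_route (hM : 2 ≤ M) (hp : p < M) (hq : q < M)
    (hc : c ∈ route .hyper M p q) : c = p ∨ HyperState M q (hyperOf M (top M p)) c := by
  have hmem := forall_mem_follow (fun c hc hne ↦ (HyperState.isAdvance_hyperStep hc hq hne).state)
    (hyperState_top hM hp hq) (fuel := 4 * M + 4)
  simp only [route] at hc
  split_ifs at hc with hpq htop
  · exact .inl (List.mem_singleton.1 hc)
  · exact .inr (hmem c (by rwa [← htop]))
  · exact (List.mem_cons.1 hc).imp_right (hmem c)

/-! ### Counting the searches with hypernodes -/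

open Classical in
lemma card_rightState_le (M c n : ℕ) :
    #{gQ ∈ range n ×ˢ range n | RightState M gQ.2 gQ.1 c} ≤ 3 * n := by
  refine (card_le_mul_card_image_of_maps_to (f := fun gQ ↦ gQ.2 - gQ.1) (t := range n) ?_ 3
    fun t _ ↦ ?_).trans_eq (by rw [card_range])
  · simp only [mem_filter, mem_product, mem_range]
    omega
  · rw [← card_image_of_injOn (f := fun gQ ↦ gQ.2 - hyperOf M c)]
    · refine card_greedyState_le (e := rightCoin (hyperSize M)) (s := hyperSize M)
        (t := t) (i := rank M c) _ fun d hd ↦ ?_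
      obtain ⟨gQ, hgQ, rfl⟩ := mem_image.1 hd
      obtain ⟨hstate, rfl⟩ := mem_filter.1 hgQ
      exact (mem_filter.1 hstate).2.greedy
    · intro x hx y hy hxy
      simp only [coe_filter, mem_filter, Set.mem_ofPred_eq] at hx hy
      have := hx.1.2.lt
      have := hx.1.2.le
      have := hy.1.2.lt
      have := hy.1.2.le
      dsimp only at hxy
      ext <;> omega

open Classical in
lemma card_leftState_le (M c n : ℕ) :
    #{gQ ∈ range n ×ˢ range n | LeftState M gQ.2 gQ.1 c} ≤ 3 * n := by
  refine (card_le_mul_card_image_of_maps_to (f := fun gQ ↦ gQ.1 - gQ.2) (t := range n) ?_ 3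
    fun t _ ↦ ?_).trans_eq (by rw [card_range])
  · simp only [mem_filter, mem_product, mem_range]
    omega
  · rw [← card_image_of_injOn (f := fun gQ ↦ hyperOf M c - gQ.2)]
    · refine card_greedyState_le (e := leftCoin (hyperSize M)) (s := hyperSize M)
        (t := t) (i := rank M c) _ fun d hd ↦ ?_
      obtain ⟨gQ, hgQ, rfl⟩ := mem_image.1 hd
      obtain ⟨hstate, rfl⟩ := mem_filter.1 hgQ
      exact (mem_filter.1 hstate).2.greedy
    · intro x hx y hy hxy
      simp only [coe_filter, mem_filter, Set.mem_ofPred_eq] at hx hy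
      have := hx.1.2.lt
      have := hx.1.2.le
      have := hy.1.2.lt
      have := hy.1.2.le
      dsimp only at hxy
      ext <;> omega

open Classical in
lemma card_filter_hyperOf_top_hyperOf_le (hM : 2 ≤ M) (R : ℕ → ℕ → Prop) :
    #{pq ∈ range M ×ˢ range M | R (hyperOf M (top M pq.1)) (hyperOf M pq.2)} ≤
      2 * hyperSize M * hyperSize M *
        #{gQ ∈ range (M / hyperSize M + 1) ×ˢ range (M / hyperSize M + 1) | R gQ.1 gQ.2} := by
  refine card_le_mul_card_image_of_maps_to
    (f := fun pq ↦ (hyperOf M (top M pq.1), hyperOf M pq.2)) ?_ _ fun gQ _ ↦ ?_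
  · simp only [mem_filter, mem_product, mem_range]
    exact fun pq h ↦ ⟨⟨hyperOf_lt (top_lt hM h.1.1), hyperOf_lt h.1.2⟩, h.2⟩
  · have hsub : {pq ∈ {pq ∈ range M ×ˢ range M | R (hyperOf M (top M pq.1)) (hyperOf M pq.2)} |
        (hyperOf M (top M pq.1), hyperOf M pq.2) = gQ} ⊆
        {p ∈ range M | hyperOf M (top M p) = gQ.1} ×ˢ {q ∈ range M | hyperOf M q = gQ.2} := by
      rintro ⟨p, q⟩ h
      obtain ⟨hR, rfl⟩ := mem_filter.1 h
      simpa using (mem_filter.1 hR).1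
    refine (card_le_card hsub).trans ?_
    rw [card_product]
    exact Nat.mul_le_mul (card_filter_hyperOf_top_le hM _) (card_filter_hyperOf_le M _)

lemma card_filter_hyperOf_eq_le (M c : ℕ) :
    #{pq ∈ range M ×ˢ range M | hyperOf M c = hyperOf M pq.2} ≤ M * hyperSize M := by
  have hsub : {pq ∈ range M ×ˢ range M | hyperOf M c = hyperOf M pq.2} ⊆
      range M ×ˢ {q ∈ range M | hyperOf M q = hyperOf M c} := by
    rintro ⟨p, q⟩ h
    simp only [mem_filter, mem_product] at h ⊢
    exact ⟨h.1.1, h.1.2, h.2.symm⟩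
  refine (card_le_card hsub).trans ?_
  rw [card_product, card_range]
  exact Nat.mul_le_mul_left M (card_filter_hyperOf_le M _)

lemma card_filter_fst_eq_le (M c : ℕ) : #{pq ∈ range M ×ˢ range M | c = pq.1} ≤ M := by
  have hsub : {pq ∈ range M ×ˢ range M | c = pq.1} ⊆ {c} ×ˢ range M := by
    rintro ⟨p, q⟩ h
    simp only [mem_filter, mem_product] at h
    simpa [h.2] using h.1.2
  simpa using card_le_card hsub

open Classical in
lemma routeCount_hyper_le_of_two_le (hM : 2 ≤ M) (c : ℕ) :
    routeCount .hyper M c ≤ 26 * (M * hyperSize M) := by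
  set s := hyperSize M with hs
  have hright := (card_filter_hyperOf_top_hyperOf_le hM fun g Q ↦ RightState M Q g c).trans
    (Nat.mul_le_mul_left _ (card_rightState_le M c _))
  have hleft := (card_filter_hyperOf_top_hyperOf_le hM fun g Q ↦ LeftState M Q g c).trans
    (Nat.mul_le_mul_left _ (card_leftState_le M c _))
  have hpairs : 2 * s * s * (3 * (M / s + 1)) ≤ 12 * (M * s) := by
    calc 2 * s * s * (3 * (M / s + 1)) = 6 * ((M / s * s + s) * s) := by ring
      _ ≤ 6 * ((M + M) * s) := by gcongr; exacts [Nat.div_mul_le_self M s, hyperSize_le hM]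
      _ = 12 * (M * s) := by ring
  have hsource := (card_filter_fst_eq_le M c).trans (Nat.le_mul_of_pos_right M (hyperSize_pos M))
  have hdest := card_filter_hyperOf_eq_le M c
  rw [← hs] at hright hleft hsource hdest
  have hsub : {pq ∈ range M ×ˢ range M | c ∈ route .hyper M pq.1 pq.2} ⊆
      {pq ∈ range M ×ˢ range M | c = pq.1 ∨ hyperOf M c = hyperOf M pq.2 ∨
        RightState M (hyperOf M pq.2) (hyperOf M (top M pq.1)) c ∨
        LeftState M (hyperOf M pq.2) (hyperOf M (top M pq.1)) c} := by
    intro pq h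
    obtain ⟨hpq, hc⟩ := mem_filter.1 h
    have hpM := mem_range.1 (mem_product.1 hpq).1
    have hqM := mem_range.1 (mem_product.1 hpq).2
    exact mem_filter.2
      ⟨hpq, (eq_or_hyperState_of_mem_route hM hpM hqM hc).imp_right And.right⟩
  have hcount := card_le_card hsub
  simp only [filter_or] at hcount
  have hunion := hcount.trans <| (card_union_le _ _).trans <| Nat.add_le_add_left
    ((card_union_le _ _).trans (Nat.add_le_add_left (card_union_le _ _) _)) _
  rw [routeCount]
  omega

theorem routeCount_hyper_le (M c : ℕ) :
    routeCount .hyper M c ≤ 26 * (M * (Nat.clog 2 M + 2)) := by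
  rcases Nat.lt_or_ge M 2 with hM | hM
  · calc routeCount .hyper M c ≤ M * M := by
          simpa [routeCount] using card_filter_le (range M ×ˢ range M) fun pq ↦
            c ∈ route .hyper M pq.1 pq.2
      _ ≤ 26 * (M * (Nat.clog 2 M + 2)) := by nlinarith [Nat.zero_le (M * Nat.clog 2 M)]
  · exact (routeCount_hyper_le_of_two_le hM c).trans
      (Nat.mul_le_mul_left _ (Nat.mul_le_mul_left M (hyperSize_le_clog_add_two M)))

end Row

namespace D2Tree

open Finset

variable (T : D2Tree)

/-! ### Rows and buckets -/

lemma width_of_le {r : ℕ} (h : r ≤ T.height) : T.width r = 2 ^ r := if_pos h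

lemma width_height_add_one : T.width (T.height + 1) = T.offset (2 ^ T.height) := if_neg (by omega)

lemma mem_nodes {x : ℕ × ℕ} : x ∈ T.nodes ↔ x.1 ≤ T.height + 1 ∧ x.2 < T.width x.1 := by
  obtain ⟨r, c⟩ := x
  simp only [nodes, mem_biUnion, mem_image, mem_range, Prod.mk.injEq]
  constructor
  · rintro ⟨r', hr, c', hc, rfl, rfl⟩
    exact ⟨Nat.le_of_lt_succ hr, hc⟩
  · exact fun ⟨hr, hc⟩ ↦ ⟨r, Nat.lt_succ_of_le hr, c, hc, rfl, rfl⟩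

lemma mk_mem_nodes {r c : ℕ} (hr : r ≤ T.height) : (r, c) ∈ T.nodes ↔ c < 2 ^ r := by
  rw [mem_nodes, T.width_of_le hr, and_iff_right (by simp only; omega)]

lemma mk_height_add_one_mem_nodes {c : ℕ} :
    (T.height + 1, c) ∈ T.nodes ↔ c < T.offset (2 ^ T.height) := by
  rw [mem_nodes, width_height_add_one, and_iff_right le_rfl]

variable {T} in
lemma fst_le_or_eq {x : ℕ × ℕ} (hx : x ∈ T.nodes) : x.1 ≤ T.height ∨ x.1 = T.height + 1 := by
  have := (T.mem_nodes.1 hx).1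
  omega

variable {T} in
lemma snd_lt_two_pow {x : ℕ × ℕ} (hx : x ∈ T.nodes) (h : x.1 ≤ T.height) : x.2 < 2 ^ x.1 :=
  (T.mk_mem_nodes h).1 hx

variable {T} in
lemma snd_lt_offset {x : ℕ × ℕ} (hx : x ∈ T.nodes) (h : x.1 = T.height + 1) :
    x.2 < T.offset (2 ^ T.height) :=
  T.mk_height_add_one_mem_nodes.1 (h ▸ hx)

lemma offset_succ (i : ℕ) : T.offset (i + 1) = T.offset i + T.bucketSize i :=
  sum_range_succ _ _

lemma offset_mono : Monotone T.offset :=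
  monotone_nat_of_le_succ fun i ↦ T.offset_succ i ▸ Nat.le_add_right _ _

lemma offset_lt_offset_succ {i : ℕ} (hi : i < 2 ^ T.height) : T.offset i < T.offset (i + 1) :=
  T.offset_succ i ▸ Nat.lt_add_of_pos_right (T.bucket_pos i hi)

lemma strictMonoOn_offset : StrictMonoOn T.offset (Set.Iic (2 ^ T.height)) := fun _ _ _ hj hij ↦
  (T.offset_lt_offset_succ (hij.trans_le hj)).trans_le (T.offset_mono hij)

lemma le_offset {i : ℕ} (hi : i ≤ 2 ^ T.height) : i ≤ T.offset i := by
  induction i with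
  | zero => exact Nat.zero_le _
  | succ i ih => exact (ih (by omega)).trans_lt (T.offset_lt_offset_succ hi)

lemma bucketOf_eq_iff {i q : ℕ} (hi : i < 2 ^ T.height) :
    T.bucketOf q = i ↔ T.offset i ≤ q ∧ q < T.offset (i + 1) := by
  rw [bucketOf, Nat.findGreatest_eq_iff]
  constructor
  · rintro ⟨-, hle, hmax⟩
    refine ⟨?_, lt_of_not_ge (hmax (Nat.lt_succ_self i) hi)⟩
    rcases eq_or_ne i 0 with rfl | h0
    · simp [offset]
    · exact hle h0
  · rintro ⟨hle, hlt⟩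
    exact ⟨hi.le, fun _ ↦ hle, fun j hij _ ↦ (hlt.trans_le (T.offset_mono hij)).not_ge⟩

lemma bucketOf_lt {q : ℕ} (hq : q < T.offset (2 ^ T.height)) : T.bucketOf q < 2 ^ T.height := by
  refine lt_of_le_of_ne (Nat.findGreatest_le _) fun h ↦ ?_
  have hspec : T.offset (T.bucketOf q) ≤ q :=
    Nat.findGreatest_of_ne_zero (P := fun i ↦ T.offset i ≤ q) rfl (by simp [h])
  rw [h] at hspec
  exact hspec.not_gt hq

lemma offset_bucketOf_le {q : ℕ} (hq : q < T.offset (2 ^ T.height)) :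
    T.offset (T.bucketOf q) ≤ q :=
  ((T.bucketOf_eq_iff (T.bucketOf_lt hq)).1 rfl).1

lemma lt_offset_bucketOf_add_one {q : ℕ} (hq : q < T.offset (2 ^ T.height)) :
    q < T.offset (T.bucketOf q + 1) :=
  ((T.bucketOf_eq_iff (T.bucketOf_lt hq)).1 rfl).2

lemma bucketOf_offset {i : ℕ} (hi : i < 2 ^ T.height) : T.bucketOf (T.offset i) = i :=
  (T.bucketOf_eq_iff hi).2 ⟨le_rfl, T.offset_lt_offset_succ hi⟩

lemma representative_mem_nodes {q : ℕ} (hq : q < T.offset (2 ^ T.height)) :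
    (T.height, T.bucketOf q) ∈ T.nodes :=
  (T.mk_mem_nodes le_rfl).2 (T.bucketOf_lt hq)

/-! ### Ancestors and subtrees -/

lemma ancestor_self (z : ℕ × ℕ) : T.ancestor z z.1 = z.2 := if_pos rfl

lemma ancestor_of_le {z : ℕ × ℕ} {r : ℕ} (hz : z.1 ≤ T.height) :
    T.ancestor z r = z.2 / 2 ^ (z.1 - r) := by
  unfold ancestor
  split_ifs with h
  · simp [h]
  · rfl

lemma ancestor_bucketNode {z : ℕ × ℕ} {r : ℕ} (hz : z.1 = T.height + 1) (hr : r ≤ T.height) :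
    T.ancestor z r = T.bucketOf z.2 / 2 ^ (T.height - r) := by
  rw [ancestor, if_neg (by omega), if_neg (by omega)]

lemma ancestor_bucketNode_height {z : ℕ × ℕ} (hz : z.1 = T.height + 1) :
    T.ancestor z T.height = T.bucketOf z.2 := by
  rw [T.ancestor_bucketNode hz le_rfl, Nat.sub_self, pow_zero, Nat.div_one]

variable {T} in
lemma ancestor_ancestor {z : ℕ × ℕ} {ρ r : ℕ} (hz : z ∈ T.nodes) (hr : r ≤ ρ) (hρ : ρ ≤ z.1) :
    T.ancestor (ρ, T.ancestor z ρ) r = T.ancestor z r := by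
  rcases hρ.eq_or_lt with rfl | hρz
  · rw [ancestor_self]
  rcases fst_le_or_eq hz with h | h
  · rw [T.ancestor_of_le (z := (ρ, _)) (by simp only; omega), T.ancestor_of_le h,
      T.ancestor_of_le h, Nat.div_div_eq_div_mul, ← pow_add]
    congr 2
    simp only
    omega
  · rw [T.ancestor_of_le (z := (ρ, _)) (by simp only; omega),
      T.ancestor_bucketNode h (by omega), T.ancestor_bucketNode h (by omega),
      Nat.div_div_eq_div_mul, ← pow_add]
    congr 2
    simp only
    omega

variable {T} in
lemma ancestor_lt_width {z : ℕ × ℕ} {r : ℕ} (hz : z ∈ T.nodes) (hr : r ≤ z.1) :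
    T.ancestor z r < T.width r := by
  have div_lt {c ρ : ℕ} (hrρ : r ≤ ρ) (hc : c < 2 ^ ρ) : c / 2 ^ (ρ - r) < 2 ^ r := by
    rwa [Nat.div_lt_iff_lt_mul (by positivity), ← pow_add, Nat.add_sub_cancel' hrρ]
  rcases hr.eq_or_lt with rfl | hrz
  · exact (T.ancestor_self z).symm ▸ (T.mem_nodes.1 hz).2
  rcases fst_le_or_eq hz with h | h
  · rw [T.ancestor_of_le h, T.width_of_le (by omega)]
    exact div_lt hr (snd_lt_two_pow hz h)
  · rw [T.ancestor_bucketNode h (by omega), T.width_of_le (by omega)]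
    exact div_lt (by omega) (T.bucketOf_lt (snd_lt_offset hz h))

variable {T} in
lemma mk_ancestor_mem_nodes {z : ℕ × ℕ} {r : ℕ} (hz : z ∈ T.nodes) (hr : r ≤ z.1) :
    (r, T.ancestor z r) ∈ T.nodes :=
  T.mem_nodes.2 ⟨hr.trans (T.mem_nodes.1 hz).1, ancestor_lt_width hz hr⟩

/-- The nodes below `x`: the node `x` itself and the nodes that have `x` as an ancestor, among them
the nodes of the buckets. -/
def subtree (x : ℕ × ℕ) : Finset (ℕ × ℕ) := {z ∈ T.nodes | x.1 ≤ z.1 ∧ T.ancestor z x.1 = x.2}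

variable {T} in
lemma mem_subtree {x z : ℕ × ℕ} :
    z ∈ T.subtree x ↔ z ∈ T.nodes ∧ x.1 ≤ z.1 ∧ T.ancestor z x.1 = x.2 := mem_filter

variable {T} in
lemma mem_subtree_mk_ancestor {z : ℕ × ℕ} {r : ℕ} (hz : z ∈ T.nodes) (hr : r ≤ z.1) :
    z ∈ T.subtree (r, T.ancestor z r) :=
  mem_subtree.2 ⟨hz, hr, rfl⟩

/-! ### The neighbours of an internal node in a lower row -/

lemma middle_of_le {z : ℕ × ℕ} {r : ℕ} (hz : z.1 < r) (hr : r ≤ T.height) :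
    T.middle z r = 2 ^ (r - z.1 - 1) * (2 * z.2 + 1) := by
  obtain ⟨d, rfl⟩ : ∃ d, r = z.1 + 1 + d := Nat.exists_eq_add_of_le hz
  rw [middle, if_pos hr, show z.1 + 1 + d - z.1 = d + 1 by omega, Nat.add_sub_cancel, pow_succ]
  ring

lemma middle_fst_add_one {z : ℕ × ℕ} (hz : z.1 < T.height) :
    T.middle z (z.1 + 1) = 2 * z.2 + 1 := by
  simp [T.middle_of_le (Nat.lt_succ_self z.1) hz]

lemma middle_height_add_one (z : ℕ × ℕ) :
    T.middle z (T.height + 1) = T.offset (T.middle z T.height) := by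
  rw [middle, if_neg (by omega), middle, if_pos le_rfl]

lemma middle_eq_mul {z : ℕ × ℕ} {ρ r : ℕ} (hz : z.1 < ρ) (hρ : ρ ≤ r) (hr : r ≤ T.height) :
    T.middle z r = T.middle z ρ * 2 ^ (r - ρ) := by
  rw [T.middle_of_le (by omega) hr, T.middle_of_le hz (by omega),
    show r - z.1 - 1 = (ρ - z.1 - 1) + (r - ρ) by omega, pow_add]
  ring

lemma middle_pos {z : ℕ × ℕ} {r : ℕ} (hz : z.1 < r) (hr : r ≤ T.height) : 0 < T.middle z r := by
  rw [T.middle_of_le hz hr]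
  positivity

variable {T} in
lemma middle_lt_two_pow {z : ℕ × ℕ} {r : ℕ} (hz : z ∈ T.nodes) (hzr : z.1 < r)
    (hr : r ≤ T.height) : T.middle z r < 2 ^ r := by
  have := snd_lt_two_pow hz (by omega)
  calc T.middle z r = 2 ^ (r - z.1 - 1) * (2 * z.2 + 1) := T.middle_of_le hzr hr
    _ < 2 ^ (r - z.1 - 1) * 2 ^ (z.1 + 1) := by gcongr; omega
    _ = 2 ^ r := by rw [← pow_add]; congr 1; omega

variable {T} in
lemma middle_lt_width {z : ℕ × ℕ} {r : ℕ} (hz : z ∈ T.nodes) (hzH : z.1 < T.height)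
    (hzr : z.1 < r) (hr : r ≤ T.height + 1) : T.middle z r < T.width r := by
  rcases hr.eq_or_lt with rfl | hr
  · rw [middle_height_add_one, width_height_add_one]
    have hlt := middle_lt_two_pow hz hzH le_rfl
    exact T.strictMonoOn_offset hlt.le (Set.mem_Iic.2 le_rfl) hlt
  · rw [T.width_of_le (by omega)]
    exact middle_lt_two_pow hz hzr (by omega)

lemma two_pow_mul_odd_inj {i j m n : ℕ} (h : 2 ^ i * (2 * m + 1) = 2 ^ j * (2 * n + 1)) :
    i = j ∧ m = n := by
  wlog hij : i ≤ j generalizing i j m n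
  · exact (this h.symm (by omega)).imp Eq.symm Eq.symm
  obtain ⟨d, rfl⟩ := Nat.exists_eq_add_of_le hij
  rw [pow_add, mul_assoc] at h
  have h := Nat.eq_of_mul_eq_mul_left (by positivity) h
  cases d with
  | zero => omega
  | succ d => rw [pow_succ', mul_assoc] at h; omega

lemma eq_of_middle_eq {z z' : ℕ × ℕ} {r : ℕ} (hz : z.1 < r) (hz' : z'.1 < r) (hr : r ≤ T.height)
    (h : T.middle z r = T.middle z' r) : z = z' := by
  rw [T.middle_of_le hz hr, T.middle_of_le hz' hr] at h
  obtain ⟨h1, h2⟩ := two_pow_mul_odd_inj h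
  exact Prod.ext (by omega) h2

/-- The internal nodes above the row of `x` which have `x` as a neighbour in that row: `x` is the
last node of its row before them or the first one after them. -/
def flanked (x : ℕ × ℕ) : Finset (ℕ × ℕ) :=
  {z ∈ T.nodes | z.1 < x.1 ∧ z.1 < T.height ∧
    x.2 ≤ T.middle z x.1 ∧ T.middle z x.1 ≤ x.2 + 1}

variable {T} in
lemma mem_flanked {x z : ℕ × ℕ} : z ∈ T.flanked x ↔ z ∈ T.nodes ∧ z.1 < x.1 ∧ z.1 < T.height ∧
    x.2 ≤ T.middle z x.1 ∧ T.middle z x.1 ≤ x.2 + 1 := mem_filter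

variable {T} in
theorem card_flanked_le {x : ℕ × ℕ} (hx : x ∈ T.nodes) : #(T.flanked x) ≤ 2 := by
  have hcard : #(Icc x.2 (x.2 + 1)) = 2 := by rw [Nat.card_Icc]; omega
  rw [← hcard]
  refine card_le_card_of_injOn (T.middle · x.1) (fun z hz ↦ ?_) fun z hz z' hz' h ↦ ?_
  · exact mem_coe.2 (mem_Icc.2 (mem_flanked.1 hz).2.2.2)
  · obtain ⟨hzm, hzx, hzH, -⟩ := mem_flanked.1 hz
    obtain ⟨hzm', hzx', hzH', -⟩ := mem_flanked.1 hz'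
    rcases fst_le_or_eq hx with hxH | hxH
    · exact T.eq_of_middle_eq hzx hzx' hxH h
    · simp only [hxH, middle_height_add_one] at h
      exact T.eq_of_middle_eq hzH hzH' le_rfl
        (T.strictMonoOn_offset.injOn (middle_lt_two_pow hzm hzH le_rfl).le
          (middle_lt_two_pow hzm' hzH' le_rfl).le h)

variable {T} in
lemma mem_flanked_representative {u z : ℕ × ℕ} (hu : u ∈ T.nodes) (huH : u.1 = T.height + 1)
    (hz : z ∈ T.flanked u) : z ∈ T.flanked (T.height, T.bucketOf u.2) := by
  obtain ⟨hzm, -, hzH, hle, hge⟩ := mem_flanked.1 hz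
  have hq := snd_lt_offset hu huH
  have hm : T.middle z T.height ≤ 2 ^ T.height := (middle_lt_two_pow hzm hzH le_rfl).le
  have hb : T.bucketOf u.2 < 2 ^ T.height := T.bucketOf_lt hq
  rw [huH, middle_height_add_one] at hle hge
  exact mem_flanked.2 ⟨hzm, hzH, hzH,
    (T.strictMonoOn_offset.le_iff_le hb.le hm).1 ((T.offset_bucketOf_le hq).trans hle),
    (T.strictMonoOn_offset.le_iff_le hm hb).1 (hge.trans (T.lt_offset_bucketOf_add_one hq))⟩

variable {T} in
lemma mem_flanked_mk_ancestor {u z : ℕ × ℕ} {ρ : ℕ} (hu : u ∈ T.nodes) (hz : z ∈ T.flanked u)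
    (hzρ : z.1 < ρ) (hρ : ρ ≤ u.1) : z ∈ T.flanked (ρ, T.ancestor u ρ) := by
  have of_le {w : ℕ × ℕ} (hwH : w.1 ≤ T.height) (hw : z ∈ T.flanked w) (hρw : ρ ≤ w.1) :
      z ∈ T.flanked (ρ, T.ancestor w ρ) := by
    obtain ⟨hzm, -, hzH, hle, hge⟩ := mem_flanked.1 hw
    rw [T.middle_eq_mul hzρ hρw hwH] at hle hge
    refine mem_flanked.2 ⟨hzm, hzρ, hzH, ?_⟩
    simp only [T.ancestor_of_le hwH]
    refine ⟨Nat.div_le_of_le_mul (hle.trans_eq (Nat.mul_comm _ _)), ?_⟩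
    refine Nat.le_of_mul_le_mul_right (c := 2 ^ (w.1 - ρ)) ?_ (by positivity)
    rw [mul_comm (_ + 1)]
    exact hge.trans (Nat.lt_mul_div_succ w.2 (by positivity))
  rcases fst_le_or_eq hu with huH | huH
  · exact of_le huH hz hρ
  rcases hρ.eq_or_lt with rfl | hρu
  · rwa [ancestor_self]
  · rw [← ancestor_ancestor hu (show ρ ≤ T.height by omega) (by omega),
      T.ancestor_bucketNode_height huH]
    exact of_le le_rfl (mem_flanked_representative hu huH hz) (by simp only; omega)

variable {T} in
theorem mem_subtree_of_mem_flanked {u z : ℕ × ℕ} (hu : u ∈ T.nodes) (hz : z ∈ T.flanked u) :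
    u ∈ T.subtree z := by
  obtain ⟨-, hzu, hzH, -⟩ := mem_flanked.1 hz
  obtain ⟨-, -, -, hle, hge⟩ :=
    mem_flanked.1 (mem_flanked_mk_ancestor hu hz (Nat.lt_add_one z.1) hzu)
  simp only [T.middle_fst_add_one hzH] at hle hge
  refine mem_subtree.2 ⟨hu, hzu.le, ?_⟩
  rw [← ancestor_ancestor hu (Nat.le_add_right z.1 1) hzu, T.ancestor_of_le (by simpa using hzH)]
  simp only [Nat.add_sub_cancel_left, pow_one]
  omega

lemma leftLeaf_eq {u : ℕ × ℕ} : T.leftLeaf u = (T.height, T.middle u T.height - 1) := by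
  rw [leftLeaf, middle, if_pos le_rfl]

lemma rightLeaf_eq {u : ℕ × ℕ} : T.rightLeaf u = (T.height, T.middle u T.height) := by
  rw [rightLeaf, middle, if_pos le_rfl]

variable {T} in
lemma mem_flanked_of_eq_leaf {u x : ℕ × ℕ} (hu : u ∈ T.nodes) (huH : u.1 < T.height)
    (hx : x = T.leftLeaf u ∨ x = T.rightLeaf u) : x ∈ T.nodes ∧ u ∈ T.flanked x := by
  have hpos := T.middle_pos huH le_rfl
  have hlt := middle_lt_two_pow hu huH le_rfl
  rw [leftLeaf_eq, rightLeaf_eq] at hx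
  rcases hx with rfl | rfl
  · exact ⟨(T.mk_mem_nodes le_rfl).2 (by omega),
      mem_flanked.2 ⟨hu, huH, huH, by simp only; omega, by simp only; omega⟩⟩
  · exact ⟨(T.mk_mem_nodes le_rfl).2 hlt,
      mem_flanked.2 ⟨hu, huH, huH, le_rfl, Nat.le_succ _⟩⟩

/-! ### The end of the horizontal phase -/

lemma haltPos_of_le {v z : ℕ × ℕ} (h : v.1 ≤ z.1) : T.haltPos v z = T.ancestor z v.1 := if_pos h

lemma haltPos_bucketNode_leaf {v z : ℕ × ℕ} (hv : v.1 = T.height + 1) (hz : z.1 = T.height) :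
    T.haltPos v z = T.offset z.2 := by
  rw [haltPos, if_neg (by omega), if_neg (by omega)]

variable {T} in
lemma mem_flanked_haltNode {v z : ℕ × ℕ} (hz : z ∈ T.nodes)
    (hzv : z.1 < v.1) (hzH : z.1 < T.height) : z ∈ T.flanked (T.haltNode v z) := by
  refine mem_flanked.2 ⟨hz, hzv, hzH, ?_⟩
  simp only [haltNode, haltPos, if_neg hzv.not_ge, if_pos hzH]
  split_ifs <;> omega

variable {T} in
theorem haltNode_mem_nodes {v z : ℕ × ℕ} (hv : v ∈ T.nodes) (hz : z ∈ T.nodes) :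
    T.haltNode v z ∈ T.nodes := by
  refine T.mem_nodes.2 ⟨(T.mem_nodes.1 hv).1, ?_⟩
  change T.haltPos v z < T.width v.1
  rcases le_or_gt v.1 z.1 with hvz | hzv
  · rw [T.haltPos_of_le hvz]
    exact ancestor_lt_width hz hvz
  rcases lt_or_ge z.1 T.height with hzH | hzH
  · have hm := middle_lt_width hz hzH hzv (T.mem_nodes.1 hv).1
    rw [haltPos, if_neg hzv.not_ge, if_pos hzH]
    split_ifs <;> omega
  · have hvH : v.1 = T.height + 1 := by have := (T.mem_nodes.1 hv).1; omega
    have hzH : z.1 = T.height := by omega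
    have hz2 := snd_lt_two_pow hz hzH.le
    rw [T.haltPos_bucketNode_leaf hvH hzH, hvH, width_height_add_one]
    rw [hzH] at hz2
    exact T.strictMonoOn_offset hz2.le (Set.mem_Iic.2 le_rfl) hz2

lemma mem_subtree_haltNode {v z : ℕ × ℕ} (hz : z ∈ T.nodes) (h : v.1 ≤ z.1) :
    z ∈ T.subtree (T.haltNode v z) := by
  rw [haltNode, T.haltPos_of_le h]
  exact mem_subtree_mk_ancestor hz h

variable {T} in
theorem haltNode_mem_subtree {v z : ℕ × ℕ} (hv : v ∈ T.nodes) (hz : z ∈ T.nodes)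
    (h : z.1 < v.1) : T.haltNode v z ∈ T.subtree z := by
  have hu := haltNode_mem_nodes hv hz
  rcases lt_or_ge z.1 T.height with hzH | hzH
  · exact mem_subtree_of_mem_flanked hu (mem_flanked_haltNode hz h hzH)
  · have hvH : v.1 = T.height + 1 := by have := (T.mem_nodes.1 hv).1; omega
    have hzH : z.1 = T.height := by omega
    refine mem_subtree.2 ⟨hu, h.le, ?_⟩
    rw [hzH, T.ancestor_bucketNode_height (z := T.haltNode v z) hvH, haltNode,
      T.haltPos_bucketNode_leaf hvH hzH]
    exact T.bucketOf_offset (hzH ▸ snd_lt_two_pow hz hzH.le)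

/-! ### Searches follow links -/

variable {T} {k : Routing}

lemma verticalLink_child {x y : ℕ × ℕ} (hx : x.1 < T.height) (hr : y.1 = x.1 + 1)
    (hp : y.2 / 2 = x.2) : T.VerticalLink x y := .inl ⟨hx, hr, hp⟩

lemma verticalLink_father {x y : ℕ × ℕ} (hy : y.1 < T.height) (hr : x.1 = y.1 + 1)
    (hp : x.2 / 2 = y.2) : T.VerticalLink x y := .inr <| .inl ⟨hy, hr, hp⟩

lemma verticalLink_leaf {u x : ℕ × ℕ} (hu : u.1 < T.height)
    (hx : x = T.leftLeaf u ∨ x = T.rightLeaf u) : T.VerticalLink u x ∧ T.VerticalLink x u :=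
  ⟨.inr <| .inr <| .inl ⟨hu, hx⟩, .inr <| .inr <| .inr <| .inl ⟨hu, hx⟩⟩

lemma verticalLink_bucketHead (i : ℕ) :
    T.VerticalLink (T.height, i) (T.height + 1, T.offset i) :=
  .inr <| .inr <| .inr <| .inr <| .inl ⟨rfl, rfl⟩

lemma verticalLink_representative {x : ℕ × ℕ} (hx : x.1 = T.height + 1) :
    T.VerticalLink x (T.height, T.bucketOf x.2) :=
  .inr <| .inr <| .inr <| .inr <| .inr <| .inl ⟨hx, rfl⟩

lemma verticalLink_bucketNext {q : ℕ} (h : T.bucketOf q = T.bucketOf (q + 1)) :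
    T.VerticalLink (T.height + 1, q) (T.height + 1, q + 1) :=
  .inr <| .inr <| .inr <| .inr <| .inr <| .inr ⟨rfl, rfl, h, .inl rfl⟩

lemma isWalk_climb {u : ℕ × ℕ} {r : ℕ} (hu : u ∈ T.nodes) (huH : u.1 ≤ T.height) (hr : r ≤ u.1) :
    IsWalk (fun x y ↦ T.Link k x y ∧ T.Link k y x) u (r, T.ancestor u r) (climb u r) := by
  have hmem (j : ℕ) (hj : j ≤ u.1) : (u.1 - j, u.2 / 2 ^ j) ∈ T.nodes := by
    have h := mk_ancestor_mem_nodes hu (Nat.sub_le u.1 j)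
    rwa [T.ancestor_of_le huH, Nat.sub_sub_self hj] at h
  have hwalk := IsWalk.map_range (R := fun x y ↦ T.Link k x y ∧ T.Link k y x)
    (fun j ↦ (u.1 - j, u.2 / 2 ^ j)) (u.1 - r) fun j hj ↦ by
      have hfather : u.2 / 2 ^ j / 2 = u.2 / 2 ^ (j + 1) := by
        rw [Nat.div_div_eq_div_mul, pow_succ]
      have hj0 := hmem j (by omega)
      have hj1 := hmem (j + 1) (by omega)
      exact ⟨⟨hj0, hj1, .inl (verticalLink_father (by simp only; omega) (by simp only; omega)
          hfather)⟩,
        hj1, hj0, .inl (verticalLink_child (by simp only; omega) (by simp only; omega) hfather)⟩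
  simpa [climb, Nat.sub_sub_self hr, T.ancestor_of_le huH] using hwalk

lemma isWalk_ascend {u : ℕ × ℕ} {r : ℕ} (hu : u ∈ T.nodes) (hr : r ≤ T.height) (hru : r ≤ u.1) :
    IsWalk (T.Link k) u (r, T.ancestor u r) (T.ascend u r) := by
  unfold ascend
  split_ifs with huH
  · exact (isWalk_climb hu huH hru).imp fun _ _ ↦ And.left
  · have huH : u.1 = T.height + 1 := (fst_le_or_eq hu).resolve_left huH
    have hm := T.representative_mem_nodes (snd_lt_offset hu huH)
    have hclimb := (isWalk_climb (k := k) hm le_rfl hr).imp fun _ _ ↦ And.left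
    rw [← T.ancestor_bucketNode_height huH, ancestor_ancestor hu hr (by omega),
      T.ancestor_bucketNode_height huH] at hclimb
    exact hclimb.cons ⟨hu, hm, .inl (verticalLink_representative huH)⟩

lemma isWalk_bucketList {z : ℕ × ℕ} (hz : z ∈ T.nodes) (hzH : z.1 = T.height + 1) :
    IsWalk (T.Link k) (T.height + 1, T.offset (T.bucketOf z.2)) z
      ((List.range (z.2 - T.offset (T.bucketOf z.2) + 1)).map
        fun j ↦ (T.height + 1, T.offset (T.bucketOf z.2) + j)) := by
  have hq := snd_lt_offset hz hzH
  set i := T.bucketOf z.2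
  have hle : T.offset i ≤ z.2 := T.offset_bucketOf_le hq
  have hlt : z.2 < T.offset (i + 1) := T.lt_offset_bucketOf_add_one hq
  have hmem (j : ℕ) (hj : j ≤ z.2 - T.offset i) : (T.height + 1, T.offset i + j) ∈ T.nodes :=
    T.mk_height_add_one_mem_nodes.2 (by omega)
  have hbucket (j : ℕ) (hj : j ≤ z.2 - T.offset i) : T.bucketOf (T.offset i + j) = i :=
    (T.bucketOf_eq_iff (i := i) (T.bucketOf_lt hq)).2 ⟨by omega, by omega⟩
  have hwalk := IsWalk.map_range (R := T.Link k) (fun j ↦ (T.height + 1, T.offset i + j))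
    (z.2 - T.offset i) fun j hj ↦ ⟨hmem j hj.le, hmem (j + 1) hj,
      .inl (verticalLink_bucketNext ((hbucket j hj.le).trans (hbucket (j + 1) hj).symm))⟩
  have hend : (T.height + 1, T.offset i + (z.2 - T.offset i)) = z :=
    Prod.ext hzH.symm (Nat.add_sub_cancel' hle)
  rwa [hend] at hwalk

lemma isWalk_descend {z : ℕ × ℕ} {r : ℕ} (hz : z ∈ T.nodes) (hr : r ≤ T.height) (hrz : r ≤ z.1) :
    IsWalk (T.Link k) (r, T.ancestor z r) z (T.descend r z) := by
  have down {u : ℕ × ℕ} (hu : u ∈ T.nodes) (huH : u.1 ≤ T.height) (hru : r ≤ u.1) :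
      IsWalk (T.Link k) (r, T.ancestor u r) u (climb u r).reverse :=
    ((isWalk_climb hu huH hru).reverse fun _ _ ↦ And.symm).imp fun _ _ ↦ And.left
  unfold descend
  split_ifs with hzH
  · exact down hz hzH hrz
  · have hzH : z.1 = T.height + 1 := (fst_le_or_eq hz).resolve_left hzH
    have hm := T.representative_mem_nodes (snd_lt_offset hz hzH)
    have hdown := down hm le_rfl hr
    rw [← T.ancestor_bucketNode_height hzH, ancestor_ancestor hz hr (by omega),
      T.ancestor_bucketNode_height hzH] at hdown
    have hhead : (T.height + 1, T.offset (T.bucketOf z.2)) ∈ T.nodes :=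
      T.mk_height_add_one_mem_nodes.2
        ((T.offset_bucketOf_le (snd_lt_offset hz hzH)).trans_lt (snd_lt_offset hz hzH))
    exact hdown.append (isWalk_bucketList hz hzH) ⟨hm, hhead, .inl (verticalLink_bucketHead _)⟩

lemma isWalk_lookAround {u : ℕ × ℕ} (hu : u ∈ T.nodes) (huH : u.1 < T.height) :
    IsWalk (T.Link k) u (T.rightLeaf u) [u, T.leftLeaf u, u, T.rightLeaf u] := by
  have hleft := (mem_flanked_of_eq_leaf hu huH (.inl rfl)).1
  have hright := (mem_flanked_of_eq_leaf hu huH (.inr rfl)).1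
  exact .cons ⟨hu, hleft, .inl (verticalLink_leaf huH (.inl rfl)).1⟩ <|
    .cons ⟨hleft, hu, .inl (verticalLink_leaf huH (.inl rfl)).2⟩ <|
    .cons ⟨hu, hright, .inl (verticalLink_leaf huH (.inr rfl)).1⟩ <| .singleton _

lemma isWalk_verticalFrom {u z : ℕ × ℕ} (hu : u ∈ T.nodes) (hz : z ∈ T.nodes)
    (h : z ∈ T.subtree u ∨ u ∈ T.subtree z) : IsWalk (T.Link k) u z (T.verticalFrom u z) := by
  rcases eq_or_ne u z with rfl | heq
  · simpa [verticalFrom] using IsWalk.singleton u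
  rw [mem_subtree, mem_subtree] at h
  have hne : u.1 ≠ z.1 := fun hrow ↦ heq <| Prod.ext hrow <| by
    rcases h with ⟨-, -, h⟩ | ⟨-, -, h⟩
    · rw [← h, hrow, ancestor_self]
    · rw [← h, ← hrow, ancestor_self]
  have hmove : IsWalk (T.Link k) u z (if u.1 < z.1 then T.descend u.1 z else T.ascend u z.1) := by
    have hur := fst_le_or_eq hu
    have hzr := fst_le_or_eq hz
    split_ifs with hlt
    · obtain ⟨-, -, h⟩ := h.resolve_right fun h ↦ h.2.1.not_gt hlt
      simpa only [h] using isWalk_descend (k := k) hz (r := u.1) (by omega) hlt.le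
    · obtain ⟨-, -, h⟩ := h.resolve_left fun h ↦ hne (by omega)
      simpa only [h] using isWalk_ascend (k := k) hu (r := z.1) (by omega) (by omega)
  rw [verticalFrom, if_neg heq]
  by_cases huH : u.1 < T.height
  · rw [if_pos huH]
    exact (isWalk_lookAround hu huH).append hmove
      ⟨(mem_flanked_of_eq_leaf hu huH (.inr rfl)).1, hu,
        .inl (verticalLink_leaf huH (.inr rfl)).2⟩
  · rwa [if_neg huH, List.nil_append]

theorem isWalk_vertical {v z : ℕ × ℕ} (hv : v ∈ T.nodes) (hz : z ∈ T.nodes) :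
    IsWalk (T.Link k) (T.haltNode v z) z (T.vertical v z) :=
  isWalk_verticalFrom (haltNode_mem_nodes hv hz) hz <|
    (le_or_gt v.1 z.1).imp (T.mem_subtree_haltNode hz) (haltNode_mem_subtree hv hz)

theorem isWalk_horizontal {v z : ℕ × ℕ} (hv : v ∈ T.nodes) (hz : z ∈ T.nodes) :
    IsWalk (T.Link k) v (T.haltNode v z) (T.horizontal k v z) := by
  obtain ⟨hrow, hpos⟩ := T.mem_nodes.1 hv
  have hhalt : T.haltPos v z < T.width v.1 := (T.mem_nodes.1 (haltNode_mem_nodes hv hz)).2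
  have hroute : IsWalk
      (fun c d ↦ c < T.width v.1 ∧ d < T.width v.1 ∧ Row.Link k (T.width v.1) c d)
      v.2 (T.haltPos v z) (Row.route k (T.width v.1) v.2 (T.haltPos v z)) := by
    cases k with
    | table => exact Row.isWalk_route_table hpos hhalt
    | hyper => exact Row.isWalk_route_hyper hpos hhalt
  exact hroute.map (Prod.mk v.1) fun c d h ↦
    ⟨T.mem_nodes.2 ⟨hrow, h.1⟩, T.mem_nodes.2 ⟨hrow, h.2.1⟩, .inr ⟨rfl, h.2.2⟩⟩

variable (k) in
theorem isPath_search {v z : ℕ × ℕ} (hv : v ∈ T.nodes) (hz : z ∈ T.nodes) :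
    T.IsPath k v z (T.search k v z) :=
  (isWalk_horizontal hv hz).trans (isWalk_vertical hv hz)

end D2Tree

lemma expect_eval {ι β : Type*} [Fintype ι] [DecidableEq ι] [Fintype β] [Nonempty β] (i : ι)
    (f : β → ℝ) : 𝔼 t : ι → β, f (t i) = 𝔼 y, f y := by
  rw [Fintype.expect_equiv (Equiv.funSplitAt i β) (fun t ↦ f (t i)) (fun y ↦ f y.1) fun _ ↦ rfl,
    ← Finset.univ_product_univ, Finset.expect_product]
  exact Finset.expect_congr rfl fun y _ ↦ Finset.expect_const Finset.univ_nonempty (f y)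

namespace D2Tree

open Finset

variable (T : D2Tree)

/-! ### Expected visits as numbers of pairs -/

/-- The number of pairs of a source `v` and a target `z` whose path visits `x`. Divided by `N` it is
the expected number of visits of `x`. -/
def visitCount (path : ℕ × ℕ → ℕ × ℕ → List (ℕ × ℕ)) (x : ℕ × ℕ) : ℕ :=
  #{vz ∈ T.nodes ×ˢ T.nodes | x ∈ path vz.1 vz.2}

theorem expectedVisits_eq (path : ℕ × ℕ → ℕ × ℕ → List (ℕ × ℕ)) (x : ℕ × ℕ) :
    T.expectedVisits path x = T.visitCount path x / T.N := by
  rcases T.nodes.eq_empty_or_nonempty with hempty | hnonempty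
  · have : IsEmpty T.nodes := by rw [hempty]; infer_instance
    simp [expectedVisits, visitCount, hempty]
  have : Nonempty T.nodes := hnonempty.to_subtype
  calc T.expectedVisits path x
      = ∑ v : T.nodes, 𝔼 t : T.nodes → T.nodes, if x ∈ path v (t v) then (1 : ℝ) else 0 := by
        simp only [expectedVisits, card_filter, Nat.cast_sum, Nat.cast_ite, Nat.cast_one,
          Nat.cast_zero, expect_sum_comm]
    _ = ∑ v : T.nodes, (∑ z : T.nodes, if x ∈ path v z then (1 : ℝ) else 0) / T.N :=
        sum_congr rfl fun v _ ↦ by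
          rw [expect_eval v fun z : T.nodes ↦ if x ∈ path v z then (1 : ℝ) else 0,
            Fintype.expect_eq_sum_div_card, Fintype.card_coe, N]
    _ = T.visitCount path x / T.N := by
        rw [← sum_div, visitCount, card_filter, sum_product, ← sum_coe_sort T.nodes]
        push_cast
        congr 1
        refine sum_congr rfl fun v _ ↦ ?_
        rw [← sum_coe_sort T.nodes]

lemma visitCount_search_le (k : Routing) (x : ℕ × ℕ) :
    T.visitCount (T.search k) x ≤ T.visitCount (T.horizontal k) x + T.visitCount T.vertical x := by
  unfold visitCount
  refine (card_le_card fun vz h ↦ ?_).trans (card_union_le _ _)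
  rw [mem_union, mem_filter, mem_filter]
  rw [mem_filter, search, List.mem_append] at h
  exact h.2.imp (⟨h.1, ·⟩) fun hv ↦ ⟨h.1, List.mem_of_mem_tail hv⟩

/-! ### Numbers of nodes -/

lemma sum_two_pow_add_one (n : ℕ) : ∑ i ∈ range n, 2 ^ i + 1 = 2 ^ n := by
  simpa using geom_sum_mul_add (1 : ℕ) n

lemma card_row {r : ℕ} (hr : r ≤ T.height + 1) : #{z ∈ T.nodes | z.1 = r} = T.width r := by
  have himage : {z ∈ T.nodes | z.1 = r} = (range (T.width r)).image (Prod.mk r) := by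
    ext z
    simp only [mem_filter, mem_nodes, mem_image, mem_range]
    constructor
    · rintro ⟨⟨-, hz⟩, rfl⟩
      exact ⟨z.2, hz, rfl⟩
    · rintro ⟨c, hc, rfl⟩
      exact ⟨⟨hr, hc⟩, rfl⟩
  rw [himage, card_image_of_injective _ (Prod.mk_right_injective r), card_range]

lemma card_rows_le {ρ : ℕ} (hρ : ρ ≤ T.height) :
    #{v ∈ T.nodes | v.1 ≤ ρ} ≤ 2 ^ (ρ + 1) := by
  rw [card_eq_sum_card_fiberwise (f := Prod.fst) (t := range (ρ + 1)) fun v hv ↦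
    mem_coe.2 (mem_range.2 (Nat.lt_succ_of_le (mem_filter.1 hv).2)), ← sum_two_pow_add_one]
  refine (sum_le_sum fun r hr ↦ ?_).trans (Nat.le_succ _)
  have hrρ : r ≤ ρ := Nat.le_of_lt_succ (mem_range.1 hr)
  rw [← T.width_of_le (hrρ.trans hρ), ← T.card_row (by omega)]
  exact card_le_card (filter_subset_filter _ (filter_subset _ _))

lemma N_add_one : T.N + 1 = 2 ^ (T.height + 1) + T.offset (2 ^ T.height) := by
  have hN : T.N = ∑ r ∈ range (T.height + 2), T.width r := by
    rw [N, card_eq_sum_card_fiberwise (f := Prod.fst) (t := range (T.height + 2)) fun v hv ↦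
      mem_coe.2 (mem_range.2 (Nat.lt_succ_of_le (T.mem_nodes.1 hv).1))]
    exact sum_congr rfl fun r hr ↦ T.card_row (Nat.le_of_lt_succ (mem_range.1 hr))
  rw [hN, sum_range_succ, width_height_add_one, ← sum_two_pow_add_one (T.height + 1),
    sum_congr rfl fun r hr ↦ T.width_of_le (Nat.le_of_lt_succ (mem_range.1 hr))]
  ring

lemma two_pow_le_N : 2 ^ (T.height + 1) ≤ T.N := by
  have := T.N_add_one
  have := T.le_offset le_rfl
  have := Nat.one_le_two_pow (n := T.height)
  omega

lemma offset_le_N : T.offset (2 ^ T.height) ≤ T.N := by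
  have := T.N_add_one
  have := Nat.one_le_two_pow (n := T.height + 1)
  omega

lemma two_le_N : 2 ≤ T.N :=
  (Nat.pow_le_pow_right two_pos (Nat.le_add_left 1 T.height)).trans T.two_pow_le_N

lemma log_N_nonneg : 0 ≤ Real.log T.N := Real.log_natCast_nonneg T.N

lemma width_le_N {r : ℕ} (hr : r ≤ T.height + 1) : T.width r ≤ T.N :=
  (T.card_row hr).symm.trans_le (card_filter_le _ _)

variable {T} {a b : ℝ}

namespace Balanced

lemma pos (h : T.Balanced a b) : 0 < b := by
  have hbucket : (1 : ℝ) ≤ T.bucketSize 0 := by exact_mod_cast T.bucket_pos 0 (by positivity)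
  exact pos_of_mul_pos_left (one_pos.trans_le (hbucket.trans (h.1 0 (by positivity))))
    T.log_N_nonneg

lemma two_pow_mul_log_le (h : T.Balanced a b) (ha : 0 < a) :
    2 ^ T.height * Real.log T.N ≤ T.N / a := by
  have hN : (T.offset (2 ^ T.height) : ℝ) ≤ T.N := by exact_mod_cast T.offset_le_N
  rw [le_div_iff₀ ha]
  linarith [h.2]

lemma offset_add_le (h : T.Balanced a b) {i n : ℕ} (hin : i + n ≤ 2 ^ T.height) :
    (T.offset (i + n) : ℝ) ≤ T.offset i + n * (b * Real.log T.N) := by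
  induction n with
  | zero => simp
  | succ n ih =>
    have hn := ih (by omega)
    have hsize := h.1 (i + n) (by omega)
    rw [← add_assoc, T.offset_succ]
    push_cast
    linarith

end Balanced

/-! ### Sizes of subtrees -/

lemma card_subtree_row_le {x : ℕ × ℕ} {r : ℕ} (hr : r ≤ T.height) :
    #{z ∈ T.subtree x | z.1 = r} ≤ 2 ^ (r - x.1) := by
  have hcard : #(Ico (x.2 * 2 ^ (r - x.1)) ((x.2 + 1) * 2 ^ (r - x.1))) = 2 ^ (r - x.1) := by
    rw [Nat.card_Ico, Nat.add_one_mul, Nat.add_sub_cancel_left]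
  rw [← hcard]
  refine card_le_card_of_injOn Prod.snd (fun z hz ↦ ?_) fun z hz z' hz' h ↦ ?_
  · obtain ⟨hz, hzr⟩ := mem_filter.1 hz
    obtain ⟨-, -, hanc⟩ := mem_subtree.1 hz
    rw [T.ancestor_of_le (hzr.trans_le hr), hzr] at hanc
    rw [← hanc, coe_Ico, Set.mem_Ico, mul_comm (_ + 1)]
    exact ⟨Nat.div_mul_le_self _ _, Nat.lt_mul_div_succ _ (by positivity)⟩
  · exact Prod.ext ((mem_filter.1 hz).2.trans (mem_filter.1 hz').2.symm) h

lemma card_subtree_rows_le {x : ℕ × ℕ} (hx : x.1 ≤ T.height) :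
    #{z ∈ T.subtree x | z.1 ≤ T.height} ≤ 2 ^ (T.height - x.1 + 1) := by
  rw [card_eq_sum_card_fiberwise (f := fun z ↦ z.1 - x.1) (t := range (T.height - x.1 + 1))
    fun z hz ↦ mem_coe.2 (mem_range.2 (by have := (mem_filter.1 hz).2; simp only; omega)),
    ← sum_two_pow_add_one]
  refine (sum_le_sum fun j hj ↦ ?_).trans (Nat.le_succ _)
  have hj := mem_range.1 hj
  calc _ ≤ #{z ∈ T.subtree x | z.1 = x.1 + j} := card_le_card fun z hz ↦ by
        simp only [mem_filter] at hz ⊢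
        have := (mem_subtree.1 hz.1.1).2.1
        exact ⟨hz.1.1, by omega⟩
    _ ≤ 2 ^ j := by
        simpa using card_subtree_row_le (x := x) (r := x.1 + j) (by omega)

lemma Balanced.card_subtree_buckets_le (h : T.Balanced a b) {x : ℕ × ℕ} (hxm : x ∈ T.nodes)
    (hx : x.1 ≤ T.height) :
    (#{z ∈ T.subtree x | ¬ z.1 ≤ T.height} : ℝ) ≤ 2 ^ (T.height - x.1) * (b * Real.log T.N) := by
  set n := 2 ^ (T.height - x.1) with hn
  have hin : x.2 * n + n ≤ 2 ^ T.height := by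
    rw [← Nat.add_one_mul, ← Nat.add_sub_cancel' hx, pow_add]
    exact Nat.mul_le_mul_right _ (snd_lt_two_pow hxm hx)
  have hcard : #{z ∈ T.subtree x | ¬ z.1 ≤ T.height} ≤
      T.offset (x.2 * n + n) - T.offset (x.2 * n) := by
    rw [← Nat.card_Ico]
    refine card_le_card_of_injOn Prod.snd (fun z hz ↦ ?_) fun z hz z' hz' heq ↦ ?_
    · obtain ⟨hz, hzH⟩ := mem_filter.1 hz
      obtain ⟨hzm, -, hanc⟩ := mem_subtree.1 hz
      have hzH := (fst_le_or_eq hzm).resolve_left hzH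
      have hq := snd_lt_offset hzm hzH
      rw [T.ancestor_bucketNode hzH hx] at hanc
      rw [← hanc, coe_Ico, Set.mem_Ico, ← Nat.add_one_mul, mul_comm (_ + 1)]
      exact ⟨(T.offset_mono (Nat.div_mul_le_self _ _)).trans (T.offset_bucketOf_le hq),
        (T.lt_offset_bucketOf_add_one hq).trans_le
          (T.offset_mono (Nat.lt_mul_div_succ _ (by positivity)))⟩
    · have eq_row {z : ℕ × ℕ} (hz : z ∈ ({z ∈ T.subtree x | ¬ z.1 ≤ T.height} : Finset _)) :
          z.1 = T.height + 1 :=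
        (fst_le_or_eq (mem_subtree.1 (mem_filter.1 hz).1).1).resolve_left (mem_filter.1 hz).2
      exact Prod.ext ((eq_row hz).trans (eq_row hz').symm) heq
  have hcard : (#{z ∈ T.subtree x | ¬ z.1 ≤ T.height} : ℝ) ≤
      T.offset (x.2 * n + n) - T.offset (x.2 * n) := by
    rw [← Nat.cast_sub (T.offset_mono (Nat.le_add_right _ _))]
    exact_mod_cast hcard
  have hoffset := h.offset_add_le hin
  rw [hn, Nat.cast_pow, Nat.cast_two] at hoffset
  linarith

lemma card_subtree_bucketNode_le {x : ℕ × ℕ} (hx : x.1 = T.height + 1) : #(T.subtree x) ≤ 1 := by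
  refine card_le_one_iff_subset_singleton.2 ⟨x, fun z hz ↦ mem_singleton.2 ?_⟩
  obtain ⟨hzm, hxz, hanc⟩ := mem_subtree.1 hz
  have hrow : z.1 = x.1 := by have := (T.mem_nodes.1 hzm).1; omega
  rw [← hrow, ancestor_self] at hanc
  exact Prod.ext hrow hanc

theorem Balanced.card_subtree_mul_width_le (h : T.Balanced a b) (ha : 0 < a) {x : ℕ × ℕ}
    (hx : x ∈ T.nodes) : (#(T.subtree x) : ℝ) * T.width x.1 ≤ (1 + b / a) * T.N := by
  have hb := h.pos
  rcases fst_le_or_eq hx with hxH | hxH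
  · have hsplit := card_filter_add_card_filter_not (s := T.subtree x) fun z ↦ z.1 ≤ T.height
    have hrows : (#{z ∈ T.subtree x | z.1 ≤ T.height} : ℝ) ≤ 2 ^ (T.height - x.1 + 1) := by
      exact_mod_cast card_subtree_rows_le hxH
    have hN : (2 : ℝ) ^ (T.height + 1) ≤ T.N := by exact_mod_cast T.two_pow_le_N
    have hpow : (2 : ℝ) ^ (T.height - x.1) * 2 ^ x.1 = 2 ^ T.height := by
      rw [← pow_add, Nat.sub_add_cancel hxH]
    rw [T.width_of_le hxH, ← hsplit]
    push_cast
    calc _ ≤ (2 ^ (T.height - x.1 + 1) + 2 ^ (T.height - x.1) * (b * Real.log T.N)) *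
          (2 : ℝ) ^ x.1 := by
          gcongr
          exact h.card_subtree_buckets_le hx hxH
      _ = 2 ^ (T.height + 1) + b * (2 ^ T.height * Real.log T.N) := by
          rw [pow_succ, pow_succ, ← hpow]
          ring
      _ ≤ T.N + b * (T.N / a) := by
          gcongr
          exact h.two_pow_mul_log_le ha
      _ = (1 + b / a) * T.N := by ring
  · have hcard : (#(T.subtree x) : ℝ) ≤ 1 := by exact_mod_cast card_subtree_bucketNode_le hxH
    have hw : (T.width x.1 : ℝ) ≤ T.N := by exact_mod_cast T.width_le_N hxH.le
    calc (#(T.subtree x) : ℝ) * T.width x.1 ≤ 1 * T.N := by gcongr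
      _ ≤ (1 + b / a) * T.N := by
          gcongr
          exact le_add_of_nonneg_right (by positivity)

/-! ### Targets with a given halting node -/

variable (T) in
open Classical in
/-- The targets for which the horizontal phase of some search halts at `u`. -/
noncomputable def haltTargets (u : ℕ × ℕ) : Finset (ℕ × ℕ) :=
  {z ∈ T.nodes | ∃ v ∈ T.nodes, T.haltNode v z = u}

lemma mem_haltTargets {u v z : ℕ × ℕ} (hv : v ∈ T.nodes) (hz : z ∈ T.nodes)
    (h : T.haltNode v z = u) : z ∈ T.haltTargets u :=
  mem_filter.2 ⟨hz, v, hv, h⟩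

lemma haltTargets_subset (u : ℕ × ℕ) :
    T.haltTargets u ⊆ insert (T.height, T.bucketOf u.2) (T.subtree u ∪ T.flanked u) := by
  intro z hzu
  obtain ⟨hz, v, hv, rfl⟩ := mem_filter.1 hzu
  rw [mem_insert, mem_union]
  rcases le_or_gt v.1 z.1 with hvz | hzv
  · exact .inr (.inl (T.mem_subtree_haltNode hz hvz))
  rcases lt_or_ge z.1 T.height with hzH | hzH
  · exact .inr (.inr (mem_flanked_haltNode hz hzv hzH))
  · have hvH : v.1 = T.height + 1 := by have := (T.mem_nodes.1 hv).1; omega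
    have hzH : z.1 = T.height := by omega
    refine .inl (Prod.ext hzH ?_)
    simp only [haltNode, T.haltPos_bucketNode_leaf hvH hzH]
    exact (T.bucketOf_offset (hzH ▸ snd_lt_two_pow hz hzH.le)).symm

theorem Balanced.card_haltTargets_mul_width_le (h : T.Balanced a b) (ha : 0 < a) {u : ℕ × ℕ}
    (hu : u ∈ T.nodes) : (#(T.haltTargets u) : ℝ) * T.width u.1 ≤ (4 + b / a) * T.N := by
  have hcard : #(T.haltTargets u) ≤ #(T.subtree u) + 3 :=
    calc #(T.haltTargets u) ≤ #(T.subtree u ∪ T.flanked u) + 1 :=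
          (card_le_card (haltTargets_subset u)).trans (card_insert_le _ _)
      _ ≤ #(T.subtree u) + 2 + 1 := by
          gcongr
          exact (card_union_le _ _).trans (Nat.add_le_add_left (card_flanked_le hu) _)
  have hcard : (#(T.haltTargets u) : ℝ) ≤ #(T.subtree u) + 3 := by exact_mod_cast hcard
  have hw : (T.width u.1 : ℝ) ≤ T.N := by exact_mod_cast T.width_le_N (T.mem_nodes.1 hu).1
  calc (#(T.haltTargets u) : ℝ) * T.width u.1
      ≤ (#(T.subtree u) + 3) * T.width u.1 := by gcongr
    _ ≤ (1 + b / a) * T.N + 3 * T.N := by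
        rw [add_mul]
        exact add_le_add (h.card_subtree_mul_width_le ha hu) (by gcongr)
    _ = (4 + b / a) * T.N := by ring

/-! ### Visits of the horizontal phase -/

lemma card_horizontal_fiber_le (k : Routing) (x pq : ℕ × ℕ) :
    #{vz ∈ T.nodes ×ˢ T.nodes | x ∈ T.horizontal k vz.1 vz.2 ∧
      (vz.1.2, T.haltPos vz.1 vz.2) = pq} ≤ #(T.haltTargets (x.1, pq.2)) := by
  rw [← one_mul #(T.haltTargets _), ← card_singleton (x.1, pq.1), ← card_product]
  refine card_le_card fun vz h ↦ ?_
  obtain ⟨hvz, hx, rfl⟩ := mem_filter.1 h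
  obtain ⟨hv, hz⟩ := mem_product.1 hvz
  obtain ⟨_, -, rfl⟩ := List.mem_map.1 hx
  rw [mem_product, mem_singleton]
  exact ⟨rfl, mem_haltTargets hv hz rfl⟩

theorem Balanced.visitCount_horizontal_le (h : T.Balanced a b) (ha : 0 < a) (k : Routing)
    {x : ℕ × ℕ} (hx : x ∈ T.nodes) {B : ℕ}
    (hB : Row.routeCount k (T.width x.1) x.2 ≤ B * T.width x.1) :
    (T.visitCount (T.horizontal k) x : ℝ) ≤ (4 + b / a) * B * T.N := by
  have hb := h.pos
  have hrow := (T.mem_nodes.1 hx).1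
  set M := T.width x.1
  have hM : 0 < M := Nat.zero_lt_of_lt (T.mem_nodes.1 hx).2
  set I : Finset (ℕ × ℕ) := {pq ∈ range M ×ˢ range M | x.2 ∈ Row.route k M pq.1 pq.2}
  have hmaps : ∀ vz ∈ ({vz ∈ T.nodes ×ˢ T.nodes | x ∈ T.horizontal k vz.1 vz.2} : Finset _),
      (vz.1.2, T.haltPos vz.1 vz.2) ∈ I := fun vz hvz ↦ by
    obtain ⟨hvz, hmem⟩ := mem_filter.1 hvz
    obtain ⟨hv, hz⟩ := mem_product.1 hvz
    obtain ⟨c, hc, rfl⟩ := List.mem_map.1 hmem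
    exact mem_filter.2 ⟨mem_product.2 ⟨mem_range.2 (T.mem_nodes.1 hv).2,
      mem_range.2 (T.mem_nodes.1 (haltNode_mem_nodes hv hz)).2⟩, hc⟩
  have hfiber : ∀ pq ∈ I, (#(T.haltTargets (x.1, pq.2)) : ℝ) ≤ (4 + b / a) * T.N / M := by
    intro pq hpq
    rw [le_div_iff₀ (by exact_mod_cast hM)]
    exact h.card_haltTargets_mul_width_le ha (u := (x.1, pq.2))
      (T.mem_nodes.2 ⟨hrow, mem_range.1 (mem_product.1 (mem_filter.1 hpq).1).2⟩)
  calc (T.visitCount (T.horizontal k) x : ℝ)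
      ≤ ∑ pq ∈ I, (#(T.haltTargets (x.1, pq.2)) : ℝ) := by
        rw [visitCount, card_eq_sum_card_fiberwise hmaps]
        push_cast
        gcongr with pq
        rw [filter_filter]
        exact card_horizontal_fiber_le k x pq
    _ ≤ #I • ((4 + b / a) * T.N / M) := sum_le_card_nsmul _ _ _ hfiber
    _ ≤ (B * M : ℕ) • ((4 + b / a) * T.N / M) := by
        gcongr
        exact hB
    _ = (4 + b / a) * B * T.N := by
        rw [nsmul_eq_mul]
        push_cast
        field_simp

/-! ### Visits of the vertical phase -/

theorem Balanced.card_haltPairs_le (h : T.Balanced a b) (ha : 0 < a) {u : ℕ × ℕ}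
    (hu : u ∈ T.nodes) :
    (#{vz ∈ T.nodes ×ˢ T.nodes | T.haltNode vz.1 vz.2 = u} : ℝ) ≤ (4 + b / a) * T.N := by
  refine le_trans ?_ (h.card_haltTargets_mul_width_le ha hu)
  rw [← T.card_row (T.mem_nodes.1 hu).1, mul_comm, ← Nat.cast_mul, ← card_product, Nat.cast_le]
  refine card_le_card fun vz h ↦ ?_
  obtain ⟨hvz, rfl⟩ := mem_filter.1 h
  obtain ⟨hv, hz⟩ := mem_product.1 hvz
  exact mem_product.2 ⟨mem_filter.2 ⟨hv, rfl⟩, mem_haltTargets hv hz rfl⟩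

variable (T) in
/-- The node of the binary tree that `x` belongs to: `x` itself, or the representative of `x` if `x`
is a bucket node. -/
def treeNode (x : ℕ × ℕ) : ℕ × ℕ := if x.1 ≤ T.height then x else (T.height, T.bucketOf x.2)

lemma treeNode_of_le {x : ℕ × ℕ} (hx : x.1 ≤ T.height) : T.treeNode x = x := if_pos hx

lemma treeNode_bucketNode {x : ℕ × ℕ} (hx : x.1 = T.height + 1) :
    T.treeNode x = (T.height, T.bucketOf x.2) := if_neg (by omega)

lemma treeNode_mem_nodes {x : ℕ × ℕ} (hx : x ∈ T.nodes) : T.treeNode x ∈ T.nodes := by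
  rcases fst_le_or_eq hx with hxH | hxH
  · rwa [treeNode_of_le hxH]
  · rw [treeNode_bucketNode hxH]
    exact T.representative_mem_nodes (snd_lt_offset hx hxH)

lemma treeNode_fst_le (x : ℕ × ℕ) : (T.treeNode x).1 ≤ T.height := by
  unfold treeNode
  split_ifs with h
  exacts [h, le_rfl]

lemma mem_subtree_trans {x y z : ℕ × ℕ} (hzy : z ∈ T.subtree y) (hyx : y ∈ T.subtree x) :
    z ∈ T.subtree x := by
  obtain ⟨hz, hyz, hzy⟩ := mem_subtree.1 hzy
  obtain ⟨-, hxy, hyx⟩ := mem_subtree.1 hyx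
  refine mem_subtree.2 ⟨hz, hxy.trans hyz, ?_⟩
  rw [← hyx, ← ancestor_ancestor hz hxy hyz, hzy]

lemma mem_subtree_representative {z : ℕ × ℕ} (hz : z ∈ T.nodes) (hzH : z.1 = T.height + 1) :
    z ∈ T.subtree (T.height, T.bucketOf z.2) := by
  rw [← T.ancestor_bucketNode_height hzH]
  exact mem_subtree_mk_ancestor hz (by omega)

lemma mem_climb {u x : ℕ × ℕ} {r : ℕ} (hu : u ∈ T.nodes) (huH : u.1 ≤ T.height) (hr : r ≤ u.1)
    (h : x ∈ climb u r) : r ≤ x.1 ∧ x.1 ≤ T.height ∧ u ∈ T.subtree x := by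
  obtain ⟨j, hj, rfl⟩ := List.mem_map.1 h
  have hj := List.mem_range.1 hj
  refine ⟨by simp only; omega, by simp only; omega, mem_subtree.2 ⟨hu, Nat.sub_le _ _, ?_⟩⟩
  rw [T.ancestor_of_le huH, Nat.sub_sub_self (by omega)]

lemma mem_ascend {u x : ℕ × ℕ} {r : ℕ} (hu : u ∈ T.nodes) (hr : r ≤ T.height) (hru : r ≤ u.1)
    (h : x ∈ T.ascend u r) : r ≤ x.1 ∧ u ∈ T.subtree x := by
  unfold ascend at h
  split_ifs at h with huH
  · obtain ⟨hrx, -, hux⟩ := mem_climb hu huH hru h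
    exact ⟨hrx, hux⟩
  have huH : u.1 = T.height + 1 := (fst_le_or_eq hu).resolve_left huH
  rcases List.mem_cons.1 h with rfl | h
  · exact ⟨hru, mem_subtree.2 ⟨hu, le_rfl, T.ancestor_self x⟩⟩
  · obtain ⟨hrx, -, hux⟩ :=
      mem_climb (T.representative_mem_nodes (snd_lt_offset hu huH)) le_rfl hr h
    exact ⟨hrx, mem_subtree_trans (mem_subtree_representative hu huH) hux⟩

lemma mem_descend {x z : ℕ × ℕ} {r : ℕ} (hz : z ∈ T.nodes) (hr : r ≤ T.height) (hrz : r ≤ z.1)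
    (h : x ∈ T.descend r z) : r ≤ (T.treeNode x).1 ∧ z ∈ T.subtree (T.treeNode x) := by
  unfold descend at h
  split_ifs at h with hzH
  · obtain ⟨hrx, hxH, hzx⟩ := mem_climb hz hzH hrz (List.mem_reverse.1 h)
    rw [treeNode_of_le hxH]
    exact ⟨hrx, hzx⟩
  have hzH : z.1 = T.height + 1 := (fst_le_or_eq hz).resolve_left hzH
  have hq := snd_lt_offset hz hzH
  rcases List.mem_append.1 h with h | h
  · obtain ⟨hrx, hxH, hzx⟩ :=
      mem_climb (T.representative_mem_nodes hq) le_rfl hr (List.mem_reverse.1 h)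
    rw [treeNode_of_le hxH]
    exact ⟨hrx, mem_subtree_trans (mem_subtree_representative hz hzH) hzx⟩
  · obtain ⟨j, hj, rfl⟩ := List.mem_map.1 h
    have hj := List.mem_range.1 hj
    have hle := T.offset_bucketOf_le hq
    have hlt := T.lt_offset_bucketOf_add_one hq
    have hbucket : T.bucketOf (T.offset (T.bucketOf z.2) + j) = T.bucketOf z.2 :=
      (T.bucketOf_eq_iff (T.bucketOf_lt hq)).2 ⟨by omega, by omega⟩
    rw [treeNode_bucketNode rfl, hbucket]
    exact ⟨hr, mem_subtree_representative hz hzH⟩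

lemma eq_or_mem_flanked_of_mem_ascend {v z x : ℕ × ℕ} (hv : v ∈ T.nodes) (hz : z ∈ T.nodes)
    (hzv : z.1 < v.1) (hx : x ∈ T.ascend (T.haltNode v z) z.1) :
    x = T.haltNode v z ∨ x = z ∨ z ∈ T.flanked x := by
  have hu := haltNode_mem_nodes hv hz
  have hvrow := (T.mem_nodes.1 hv).1
  obtain ⟨hzx, hux⟩ := mem_ascend hu (by omega) hzv.le hx
  obtain ⟨-, hxu, hanc⟩ := mem_subtree.1 hux
  rcases hzx.eq_or_lt with hzx | hzx
  · obtain ⟨-, -, hancz⟩ := mem_subtree.1 (haltNode_mem_subtree hv hz hzv)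
    exact .inr <| .inl <| Prod.ext hzx.symm (by rw [← hanc, ← hzx, hancz])
  rcases hxu.eq_or_lt with hxu | hxu
  · exact .inl <| Prod.ext hxu (by rw [← hanc, hxu, ancestor_self])
  · have hzH : z.1 < T.height := by
      have : x.1 < v.1 := hxu
      omega
    have hflanked := mem_flanked_mk_ancestor hu (mem_flanked_haltNode hz hzv hzH) hzx hxu.le
    rw [hanc] at hflanked
    exact .inr <| .inr hflanked

theorem mem_vertical {v z x : ℕ × ℕ} (hv : v ∈ T.nodes) (hz : z ∈ T.nodes)
    (hx : x ∈ T.vertical v z) :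
    T.haltNode v z ∈ insert x (T.flanked x) ∨ z ∈ insert x (T.flanked x) ∨
      v.1 ≤ (T.treeNode x).1 ∧ z ∈ T.subtree (T.treeNode x) := by
  have hu := haltNode_mem_nodes hv hz
  simp only [mem_insert]
  unfold vertical verticalFrom at hx
  by_cases heq : T.haltNode v z = z
  · rw [if_pos heq, List.mem_singleton] at hx
    exact .inl (.inl hx.symm)
  rw [if_neg heq, List.mem_append] at hx
  rcases hx with hx | hx
  · split_ifs at hx with huH
    · have hleaf (h : x = T.leftLeaf (T.haltNode v z) ∨ x = T.rightLeaf (T.haltNode v z)) :=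
        (mem_flanked_of_eq_leaf hu huH h).2
      simp only [List.mem_cons, List.not_mem_nil, or_false] at hx
      rcases hx with h | h | h | h
      exacts [.inl (.inl h.symm), .inl (.inr (hleaf (.inl h))), .inl (.inl h.symm),
        .inl (.inr (hleaf (.inr h)))]
    · exact absurd hx List.not_mem_nil
  have hrow : (T.haltNode v z).1 = v.1 := rfl
  have hne : v.1 ≠ z.1 := fun h ↦ heq <| Prod.ext h <| by
    rw [haltNode, T.haltPos_of_le h.le, h, ancestor_self]
  have := (T.mem_nodes.1 hz).1
  split_ifs at hx with hvz
  · exact .inr <| .inr <| mem_descend hz (by omega) hvz.le hx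
  · rcases eq_or_mem_flanked_of_mem_ascend hv hz (by omega) hx with h | h | h
    exacts [.inl (.inl h.symm), .inr (.inl (.inl h.symm)), .inr (.inl (.inr h))]

lemma card_insert_flanked_le {x : ℕ × ℕ} (hx : x ∈ T.nodes) : #(insert x (T.flanked x)) ≤ 3 :=
  (card_insert_le _ _).trans (Nat.add_le_add_right (card_flanked_le hx) 1)

namespace Balanced

lemma card_haltNode_mem_insert_flanked_le (h : T.Balanced a b) (ha : 0 < a) {x : ℕ × ℕ}
    (hx : x ∈ T.nodes) :
    (#{vz ∈ T.nodes ×ˢ T.nodes | T.haltNode vz.1 vz.2 ∈ insert x (T.flanked x)} : ℝ) ≤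
      3 * ((4 + b / a) * T.N) := by
  have hb := h.pos
  have hnode : ∀ u ∈ insert x (T.flanked x), u ∈ T.nodes := fun u hu ↦
    (mem_insert.1 hu).elim (fun h ↦ h ▸ hx) fun h ↦ (mem_flanked.1 h).1
  have hmaps : ∀ vz ∈ ({vz ∈ T.nodes ×ˢ T.nodes |
      T.haltNode vz.1 vz.2 ∈ insert x (T.flanked x)} : Finset _),
      T.haltNode vz.1 vz.2 ∈ insert x (T.flanked x) := fun vz hvz ↦ (mem_filter.1 hvz).2
  rw [card_eq_sum_card_fiberwise hmaps]
  push_cast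
  calc _ ≤ #(insert x (T.flanked x)) • ((4 + b / a) * T.N) :=
        sum_le_card_nsmul _ _ _ fun u hu ↦ le_trans
          (Nat.cast_le.2 (card_le_card (filter_subset_filter _ (filter_subset _ _))))
          (h.card_haltPairs_le ha (hnode u hu))
    _ ≤ 3 • ((4 + b / a) * T.N) := by
        gcongr
        exact card_insert_flanked_le hx
    _ = 3 * ((4 + b / a) * T.N) := by norm_num

lemma card_rows_mul_card_subtree_le (h : T.Balanced a b) (ha : 0 < a) {x : ℕ × ℕ}
    (hx : x ∈ T.nodes) (hxH : x.1 ≤ T.height) :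
    (#{v ∈ T.nodes | v.1 ≤ x.1} * #(T.subtree x) : ℝ) ≤ 2 * ((1 + b / a) * T.N) := by
  have hrows : (#{v ∈ T.nodes | v.1 ≤ x.1} : ℝ) ≤ 2 * T.width x.1 := by
    rw [T.width_of_le hxH]
    exact_mod_cast (T.card_rows_le hxH).trans_eq (pow_succ' _ _)
  calc _ ≤ 2 * (T.width x.1 : ℝ) * #(T.subtree x) := by gcongr
    _ = 2 * (#(T.subtree x) * T.width x.1) := by ring
    _ ≤ 2 * ((1 + b / a) * T.N) :=
        mul_le_mul_of_nonneg_left (h.card_subtree_mul_width_le ha hx) zero_le_two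

theorem visitCount_vertical_le (h : T.Balanced a b) (ha : 0 < a) {x : ℕ × ℕ}
    (hx : x ∈ T.nodes) :
    (T.visitCount T.vertical x : ℝ) ≤ (17 + 5 * (b / a)) * T.N := by
  set halting : Finset ((ℕ × ℕ) × ℕ × ℕ) :=
    {vz ∈ T.nodes ×ˢ T.nodes | T.haltNode vz.1 vz.2 ∈ insert x (T.flanked x)}
  set ending := T.nodes ×ˢ insert x (T.flanked x)
  set descending := {v ∈ T.nodes | v.1 ≤ (T.treeNode x).1} ×ˢ T.subtree (T.treeNode x)
  have hcover : T.visitCount T.vertical x ≤ #halting + (#ending + #descending) := by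
    refine (card_le_card fun vz hvz ↦ ?_).trans <|
      (card_union_le _ _).trans (Nat.add_le_add_left (card_union_le _ _) _)
    obtain ⟨hmem, hpath⟩ := mem_filter.1 hvz
    obtain ⟨hv, hz⟩ := mem_product.1 hmem
    rw [mem_union, mem_union]
    exact (mem_vertical hv hz hpath).imp (fun h ↦ mem_filter.2 ⟨hmem, h⟩) <|
      Or.imp (fun h ↦ mem_product.2 ⟨hv, h⟩)
        fun h ↦ mem_product.2 ⟨mem_filter.2 ⟨hv, h.1⟩, h.2⟩
  have hhalting := h.card_haltNode_mem_insert_flanked_le ha hx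
  have hending : (#ending : ℝ) ≤ T.N * 3 := by
    rw [card_product]
    exact_mod_cast Nat.mul_le_mul_left T.N (card_insert_flanked_le hx)
  have hdescending : (#descending : ℝ) ≤ 2 * ((1 + b / a) * T.N) := by
    rw [card_product, Nat.cast_mul]
    exact h.card_rows_mul_card_subtree_le ha (treeNode_mem_nodes hx) (treeNode_fst_le x)
  calc (T.visitCount T.vertical x : ℝ) ≤ #halting + (#ending + #descending) := by
        exact_mod_cast hcover
    _ ≤ 3 * ((4 + b / a) * T.N) + (T.N * 3 + 2 * ((1 + b / a) * T.N)) := by gcongr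
    _ = (17 + 5 * (b / a)) * T.N := by ring

end Balanced

end D2Tree

/-! ### Stored links -/

namespace Row

open Finset

lemma mem_of_link_table {M c d : ℕ} (h : Link .table M c d) :
    d ∈ (range (Nat.clog 2 M)).image (c + 2 ^ ·) ∪ (range (Nat.clog 2 M)).image (c - 2 ^ ·) := by
  obtain ⟨i, hi, h⟩ := h
  simp only [mem_union, mem_image, mem_range]
  exact h.imp (fun h ↦ ⟨i, hi, h.symm⟩) fun h ↦ ⟨i, hi, by omega⟩

lemma mem_of_link_hyper {M c d : ℕ} (h : Link .hyper M c d) :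
    d ∈ ({c + 1, c - 1, top M c, rightEnd M c, leftEnd M c} : Finset ℕ) := by
  simp only [mem_insert, mem_singleton]
  rcases h with ⟨-, h | h⟩ | h | ⟨-, h⟩ | ⟨-, h⟩
  · exact .inl h
  · exact .inr (.inl (by omega))
  · exact .inr (.inr (.inl h))
  · exact .inr (.inr (.inr (.inl h)))
  · exact .inr (.inr (.inr (.inr h)))

end Row

namespace D2Tree

open Finset

variable {T : D2Tree} {x : ℕ × ℕ}

lemma mem_of_verticalLink {y : ℕ × ℕ} (hy : y ∈ T.nodes) (h : T.VerticalLink x y) :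
    y ∈ ({(x.1 + 1, 2 * x.2), (x.1 + 1, 2 * x.2 + 1), (x.1 - 1, x.2 / 2), T.leftLeaf x,
        T.rightLeaf x} : Finset (ℕ × ℕ)) ∪
      {(T.height + 1, T.offset x.2), (T.height, T.bucketOf x.2), (T.height + 1, x.2 + 1),
        (T.height + 1, x.2 - 1)} ∪ T.flanked x := by
  simp only [mem_union, mem_insert, mem_singleton]
  rcases h with ⟨-, hrow, hpos⟩ | ⟨-, hrow, hpos⟩ | ⟨-, hleaf⟩ | ⟨hyH, hleaf⟩ | ⟨-, hfirst⟩ |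
    ⟨-, hrepr⟩ | ⟨-, hrow, -, hnext | hprev⟩
  · have hchild : y.2 = 2 * x.2 ∨ y.2 = 2 * x.2 + 1 := by omega
    exact .inl (.inl (hchild.imp (Prod.ext hrow ·) fun h ↦ .inl (Prod.ext hrow h)))
  · exact .inl (.inl (.inr (.inr (.inl (Prod.ext (Nat.eq_sub_of_add_eq hrow.symm) hpos.symm)))))
  · exact .inl (.inl (.inr (.inr (.inr hleaf))))
  · exact .inr (mem_flanked_of_eq_leaf hy hyH hleaf).2
  · exact .inl (.inr (.inl hfirst))
  · exact .inl (.inr (.inr (.inl hrepr)))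
  · exact .inl (.inr (.inr (.inr (.inl (Prod.ext hrow hnext)))))
  · exact .inl (.inr (.inr (.inr (.inr (Prod.ext hrow (Nat.eq_sub_of_add_eq hprev.symm))))))

lemma space_le {k : Routing} {s : Finset ℕ} (hx : x ∈ T.nodes)
    (hs : ∀ d, Row.Link k (T.width x.1) x.2 d → d ∈ s) : T.space k x ≤ 11 + #s := by
  calc T.space k x ≤ #((_ ∪ _ ∪ T.flanked x) ∪ s.image (Prod.mk x.1)) := by
        rw [← Set.ncard_coe_finset]
        refine Set.ncard_le_ncard (fun y hy ↦ ?_) (finite_toSet _)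
        obtain ⟨-, hy, hvert | ⟨hrow, hlink⟩⟩ := hy
        · exact mem_union_left _ (mem_of_verticalLink hy hvert)
        · exact mem_union_right _ (mem_image.2 ⟨y.2, hs _ hlink, Prod.ext hrow rfl⟩)
    _ ≤ (5 + 4 + 2) + #s := (card_union_le _ _).trans <| Nat.add_le_add
        ((card_union_le _ _).trans <| Nat.add_le_add
          ((card_union_le _ _).trans (Nat.add_le_add card_le_five card_le_four))
          (card_flanked_le hx))
        card_image_le

lemma space_table_le (hx : x ∈ T.nodes) :
    T.space .table x ≤ 11 + 2 * Nat.clog 2 (T.width x.1) := by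
  refine (space_le hx fun _ ↦ Row.mem_of_link_table).trans (Nat.add_le_add_left ?_ 11)
  refine (card_union_le _ _).trans ?_
  rw [two_mul]
  exact Nat.add_le_add (card_image_le.trans_eq (card_range _))
    (card_image_le.trans_eq (card_range _))

theorem space_hyper_le (hx : x ∈ T.nodes) : T.space .hyper x ≤ 16 :=
  (space_le hx fun _ ↦ Row.mem_of_link_hyper).trans (Nat.add_le_add_left card_le_five 11)

/-! ### Logarithms of the sizes of the rows -/

variable (T) in
lemma half_le_log_N : 1 / 2 ≤ Real.log T.N := by
  have hN : (2 : ℝ) ≤ T.N := by exact_mod_cast T.two_le_N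
  linarith [Real.log_le_log two_pos hN, Real.log_two_gt_d9]

lemma clog_width_add_two_le {r : ℕ} (hr : r ≤ T.height + 1) :
    (Nat.clog 2 (T.width r) : ℝ) + 2 ≤ 8 * Real.log T.N := by
  set n := Nat.clog 2 T.N - 1
  have hpow : (2 : ℝ) ^ n ≤ T.N := by
    exact_mod_cast (Nat.pow_pred_clog_lt_self one_lt_two T.two_le_N).le
  have hnlog : n * Real.log 2 ≤ Real.log T.N := by
    rw [← Real.log_pow]
    exact Real.log_le_log (by positivity) hpow
  have hhalf : (n : ℝ) * (1 / 2) ≤ n * Real.log 2 := by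
    gcongr
    linarith [Real.log_two_gt_d9]
  have hclog : (Nat.clog 2 (T.width r) : ℝ) ≤ n + 1 := by
    have := Nat.clog_mono_right 2 (T.width_le_N hr)
    exact_mod_cast show Nat.clog 2 (T.width r) ≤ n + 1 by omega
  linarith [T.half_le_log_N]

theorem space_table_le_log (hx : x ∈ T.nodes) : (T.space .table x : ℝ) ≤ 38 * Real.log T.N := by
  have hspace : (T.space .table x : ℝ) ≤ 11 + 2 * Nat.clog 2 (T.width x.1) := by
    exact_mod_cast space_table_le hx
  linarith [clog_width_add_two_le (T.mem_nodes.1 hx).1, T.half_le_log_N]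

variable (T) in
lemma log_N_le_two_mul_sqrt : Real.log T.N ≤ 2 * √T.N := by
  have hN : (0 : ℝ) < T.N := by exact_mod_cast two_pos.trans_le T.two_le_N
  have hlog := Real.log_le_sub_one_of_pos (Real.sqrt_pos.2 hN)
  rw [Real.log_sqrt hN.le] at hlog
  linarith

namespace Balanced

variable {a b : ℝ}

lemma N_le (h : T.Balanced a b) : (T.N : ℝ) ≤ 2 ^ T.height * (2 + b * Real.log T.N) := by
  have hN : (T.N : ℝ) + 1 = 2 ^ (T.height + 1) + T.offset (2 ^ T.height) := by
    exact_mod_cast T.N_add_one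
  have hoffset := h.offset_add_le (Nat.zero_add (2 ^ T.height)).le
  have hzero : T.offset 0 = 0 := sum_range_zero _
  rw [hzero, zero_add] at hoffset
  push_cast at hoffset
  rw [pow_succ] at hN
  linarith

lemma log_N_le (h : T.Balanced a b) :
    Real.log T.N ≤ (2 * Real.log (2 + 2 * b) + 2) * (T.height + 1) := by
  have hb := h.pos
  have hN : (1 : ℝ) ≤ T.N := by exact_mod_cast one_le_two.trans T.two_le_N
  have hsqrt : 1 ≤ √(T.N : ℝ) := Real.one_le_sqrt.2 hN
  have hsqrt_le : √(T.N : ℝ) ≤ 2 ^ T.height * (2 + 2 * b) := by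
    refine le_of_mul_le_mul_right ?_ (zero_lt_one.trans_le hsqrt)
    calc √(T.N : ℝ) * √T.N = T.N := Real.mul_self_sqrt (zero_le_one.trans hN)
      _ ≤ 2 ^ T.height * (2 + b * Real.log T.N) := h.N_le
      _ ≤ 2 ^ T.height * (2 * √T.N + b * (2 * √T.N)) := by
          gcongr
          · linarith
          · exact T.log_N_le_two_mul_sqrt
      _ = 2 ^ T.height * (2 + 2 * b) * √T.N := by ring
  have hlog : 0 ≤ Real.log (2 + 2 * b) := Real.log_nonneg (by linarith)
  calc Real.log T.N = 2 * Real.log √T.N := by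
        rw [Real.log_sqrt (zero_le_one.trans hN)]
        ring
    _ ≤ 2 * Real.log (2 ^ T.height * (2 + 2 * b)) := by gcongr
    _ = 2 * (Real.log (2 + 2 * b) * 1 + Real.log 2 * T.height) := by
        rw [Real.log_mul (by positivity) (by positivity), Real.log_pow]
        ring
    _ ≤ 2 * (Real.log (2 + 2 * b) * (T.height + 1) + 1 * (T.height + 1)) := by
        gcongr
        · linarith
        · linarith [Real.log_two_lt_d9]
        · linarith
    _ = (2 * Real.log (2 + 2 * b) + 2) * (T.height + 1) := by ring

lemma clog_width_add_one_le (h : T.Balanced a b) {r : ℕ} (hr : r ≤ T.height + 1) :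
    (Nat.clog 2 (T.width r) : ℝ) + 1 ≤ 8 * (2 * Real.log (2 + 2 * b) + 2) * (r + 1) := by
  have hlog : 0 ≤ Real.log (2 + 2 * b) := Real.log_nonneg (by linarith [h.pos])
  rcases hr.lt_or_eq with hr | rfl
  · rw [T.width_of_le (Nat.le_of_lt_succ hr), Nat.clog_pow 2 r one_lt_two]
    exact le_mul_of_one_le_left (by positivity) (by linarith)
  · have hheight : (2 * Real.log (2 + 2 * b) + 2) * (T.height + 1) ≤
        (2 * Real.log (2 + 2 * b) + 2) * ((T.height + 1 : ℕ) + 1) := by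
      gcongr
      exact Nat.le_succ _
    linarith [clog_width_add_two_le (T := T) le_rfl, h.log_N_le]

/-! ### Congestion -/

lemma expectedVisits_horizontal_le (h : T.Balanced a b) (ha : 0 < a) {k : Routing}
    (hx : x ∈ T.nodes) {B : ℕ}
    (hB : Row.routeCount k (T.width x.1) x.2 ≤ B * T.width x.1) :
    T.expectedVisits (T.horizontal k) x ≤ (4 + b / a) * B := by
  have hN : (0 : ℝ) < T.N := by exact_mod_cast two_pos.trans_le T.two_le_N
  rw [expectedVisits_eq, div_le_iff₀ hN]
  exact h.visitCount_horizontal_le ha k hx hB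

lemma expectedVisits_horizontal_table_le (h : T.Balanced a b) (ha : 0 < a) (hx : x ∈ T.nodes) :
    T.expectedVisits (T.horizontal .table) x ≤
      (4 + b / a) * (2 * (Nat.clog 2 (T.width x.1) + 1)) := by
  simpa using h.expectedVisits_horizontal_le ha hx (B := 2 * (Nat.clog 2 (T.width x.1) + 1)) <|
    (Row.routeCount_table_le _ _).trans_eq (by ring)

lemma expectedVisits_horizontal_hyper_le (h : T.Balanced a b) (ha : 0 < a) (hx : x ∈ T.nodes) :
    T.expectedVisits (T.horizontal .hyper) x ≤
      (4 + b / a) * (26 * (Nat.clog 2 (T.width x.1) + 2)) := by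
  simpa using h.expectedVisits_horizontal_le ha hx (B := 26 * (Nat.clog 2 (T.width x.1) + 2)) <|
    (Row.routeCount_hyper_le _ _).trans_eq (by ring)

theorem expectedVisits_horizontal_table_le_row (h : T.Balanced a b) (ha : 0 < a)
    (hx : x ∈ T.nodes) :
    T.expectedVisits (T.horizontal .table) x ≤
      16 * (4 + b / a) * (2 * Real.log (2 + 2 * b) + 2) * (x.1 + 1) := by
  have hb := h.pos
  calc T.expectedVisits (T.horizontal .table) x
      ≤ (4 + b / a) * (2 * (Nat.clog 2 (T.width x.1) + 1)) :=
        h.expectedVisits_horizontal_table_le ha hx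
    _ ≤ (4 + b / a) * (2 * (8 * (2 * Real.log (2 + 2 * b) + 2) * (x.1 + 1))) := by
        gcongr
        exact h.clog_width_add_one_le (T.mem_nodes.1 hx).1
    _ = 16 * (4 + b / a) * (2 * Real.log (2 + 2 * b) + 2) * (x.1 + 1) := by ring

lemma expectedVisits_horizontal_le_log (h : T.Balanced a b) (ha : 0 < a) (k : Routing)
    (hx : x ∈ T.nodes) :
    T.expectedVisits (T.horizontal k) x ≤ (4 + b / a) * (208 * Real.log T.N) := by
  have hba : 0 < b / a := div_pos h.pos ha
  have hclog := clog_width_add_two_le (T.mem_nodes.1 hx).1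
  cases k with
  | table =>
    refine (h.expectedVisits_horizontal_table_le ha hx).trans ?_
    gcongr ?_ * ?_
    linarith [T.log_N_nonneg]
  | hyper =>
    refine (h.expectedVisits_horizontal_hyper_le ha hx).trans ?_
    gcongr ?_ * ?_
    linarith

theorem expectedVisits_vertical_le (h : T.Balanced a b) (ha : 0 < a) (hx : x ∈ T.nodes) :
    T.expectedVisits T.vertical x ≤ 17 + 5 * (b / a) := by
  have hN : (0 : ℝ) < T.N := by exact_mod_cast two_pos.trans_le T.two_le_N
  rw [expectedVisits_eq, div_le_iff₀ hN]
  exact h.visitCount_vertical_le ha hx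

end Balanced

variable (T x) in
lemma expectedVisits_search_le (k : Routing) :
    T.expectedVisits (T.search k) x ≤
      T.expectedVisits (T.horizontal k) x + T.expectedVisits T.vertical x := by
  simp only [expectedVisits_eq, ← add_div]
  gcongr
  exact_mod_cast T.visitCount_search_le k x

theorem Balanced.congestion_le {a b : ℝ} (h : T.Balanced a b) (ha : 0 < a) (k : Routing) :
    T.congestion k ≤
      (208 * (4 + b / a) + 2 * (17 + 5 * (b / a))) * (Real.log T.N / T.N) := by
  have hba : 0 < b / a := div_pos h.pos ha
  have : Nonempty T.nodes := (card_pos.1 (two_pos.trans_le T.two_le_N)).to_subtype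
  refine ciSup_le fun x ↦ ?_
  calc T.expectedVisits (T.search k) x / T.N
      ≤ (T.expectedVisits (T.horizontal k) x + T.expectedVisits T.vertical x) / T.N := by
        gcongr
        exact T.expectedVisits_search_le x k
    _ ≤ ((4 + b / a) * (208 * Real.log T.N) +
          (17 + 5 * (b / a)) * (2 * Real.log T.N)) / T.N := by
        gcongr
        · exact h.expectedVisits_horizontal_le_log ha k x.2
        · refine (h.expectedVisits_vertical_le ha x.2).trans (le_mul_of_one_le_right ?_ ?_)
          · positivity
          · linarith [T.half_le_log_N]
    _ = (208 * (4 + b / a) + 2 * (17 + 5 * (b / a))) * (Real.log T.N / T.N) := by ring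

end D2Tree

theorem mainTheorem6 (a b : ℝ) (ha : 0 < a) (hb : 0 < b) :
    ∃ C : ℝ, ∀ T : D2Tree, T.Balanced a b →
      -- routing tables, `O(log N)` space per node
      ((∀ x ∈ T.nodes, (T.space .table x : ℝ) ≤ C * Real.log T.N) ∧
        (∀ v ∈ T.nodes, ∀ z ∈ T.nodes, T.IsPath .table v z (T.search .table v z)) ∧
        (∀ x ∈ T.nodes, T.expectedVisits (T.horizontal .table) x ≤ C * (x.1 + 1)) ∧
        (∀ x ∈ T.nodes, T.expectedVisits T.vertical x ≤ C) ∧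
        T.congestion .table ≤ C * (Real.log T.N / T.N)) ∧
      -- hypernodes, `O(1)` space per node
      ((∀ x ∈ T.nodes, (T.space .hyper x : ℝ) ≤ C) ∧
        (∀ v ∈ T.nodes, ∀ z ∈ T.nodes, T.IsPath .hyper v z (T.search .hyper v z)) ∧
        T.congestion .hyper ≤ C * (Real.log T.N / T.N)) := by
  have hba : 0 < b / a := div_pos hb ha
  have hlog : 0 ≤ Real.log (2 + 2 * b) := Real.log_nonneg (by linarith)
  set A := 208 * (4 + b / a) + 2 * (17 + 5 * (b / a))
  set B := 16 * (4 + b / a) * (2 * Real.log (2 + 2 * b) + 2)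
  have hB0 : 0 ≤ B := by positivity
  refine ⟨38 + A + B, fun T h ↦ ?_⟩
  have hcongestion (k : Routing) : T.congestion k ≤ (38 + A + B) * (Real.log T.N / T.N) :=
    (h.congestion_le ha k).trans <|
      mul_le_mul_of_nonneg_right (by linarith) (div_nonneg T.log_N_nonneg (Nat.cast_nonneg _))
  refine ⟨⟨fun x hx ↦ ?_, fun v hv z hz ↦ D2Tree.isPath_search .table hv hz, fun x hx ↦ ?_,
    fun x hx ↦ ?_, hcongestion .table⟩, fun x hx ↦ ?_,
    fun v hv z hz ↦ D2Tree.isPath_search .hyper hv hz, hcongestion .hyper⟩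
  · exact (D2Tree.space_table_le_log hx).trans <|
      mul_le_mul_of_nonneg_right (by linarith) T.log_N_nonneg
  · exact (h.expectedVisits_horizontal_table_le_row ha hx).trans <|
      mul_le_mul_of_nonneg_right (by linarith) (by positivity)
  · exact (h.expectedVisits_vertical_le ha hx).trans (by linarith)
  · have hspace : (T.space .hyper x : ℝ) ≤ 16 := by exact_mod_cast D2Tree.space_hyper_le hx
    linarith
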